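/- Let $k$ be a field and let $\mathcal T$ be a $k$-linear, Hom-finite, Krull--Schmidt triangulated category. For an object $X$, let $\langle X\rangle$ be its thick closure (the smallest triangulated subcategory of $\mathcal T$ that contains $X$ and is closed under direct summands), and let $\langle X\rangle_1$ be the smallest full additive subcategory that contains $X$ and is closed under direct summands and under the shifts $[n]$, $n\in\mathbb Z$. An object $G$ is called a linear generator of $\mathcal T$ if $\langle G\rangle=\mathcal T$ and: (G1) the relation "$Q\le P$ if and only if $\mathcal T(P,Q)\cong k$" is a total order on the set of isomorphism classes of indecomposable objects of $\langle G\rangle_1$, and moreover $\mathcal T(Q,P)=0$ whenever $Q\le P$ and $Q\not\cong P$; (G2) $P\le P[1]$ for every indecomposable $P\in\langle G\rangle_1$; (G3) for indecomposable $P,Q\in\langle G\rangle_1$, $P\le Q\le P[1]$ implies $Q\cong P$ or $Q\cong P[1]$; (G4) for indecomposable $R\le Q\le P$ in $\langle G\rangle_1$, every nonzero morphism $P\to R$ factors through $Q$. For a thick subcategory $\mathcal S\subseteq\mathcal T$, a compatible choice of generators for $\mathcal S$ is a family of morphisms $\alpha^{Y,Z}\colon Y\to Z$, indexed by all pairs of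 indecomposable objects $Y,Z\in\mathcal S$, such that $\alpha^{Y,Z}$ spans the $k$-vector space $\mathcal T(Y,Z)$ (so it is a basis of it if $\mathcal T(Y,Z)\ne 0$, and $\alpha^{Y,Z}=0$ otherwise) and such that $$\alpha^{Y,Z}=\alpha^{W,Z}\,\alpha^{Y,W}$$ whenever $W\in\mathcal S$ is indecomposable and $\alpha^{Y,Z}$ factors through $W$. Proposition. Suppose that $\mathcal T$ has a linear generator $G$. Then: (1) there is a compatible choice of generators for $\mathcal T$; (2) if $G'$ is a direct summand of $G$, $\mathcal S=\langle G'\rangle$, and $\{\alpha^{Y,Z}\}$ is a compatible choice of generators for $\mathcal S$, then there is a compatible choice of generators $\{\beta^{Y,Z}\}$ for $\mathcal T$ such that $\beta^{Y,Z}=\alpha^{Y,Z}$ for all indecomposable $Y,Z\in\mathcal S$. -/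

import Mathlib

open CategoryTheory CategoryTheory.Limits CategoryTheory.Pretriangulated

universe w v u

section

variable {C : Type u} [Category.{v} C] [Preadditive C] [HasZeroObject C] [HasShift C ℤ]
  [∀ n : ℤ, (shiftFunctor C n).Additive] [Pretriangulated C]

/-- The thick closure `⟨X⟩` of an object `X`: the smallest triangulated subcategory which is
closed under direct summands (retracts) and contains `X`. -/
def thickClosure (X : C) : ObjectProperty C :=
  (ObjectProperty.singleton X).triangEnvelope

/-- The subcategory `⟨X⟩₁`: the smallest full additive subcategory which contains `X` and is
closed under direct summands (retracts) and all shifts. -/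
def addClosure (X : C) : ObjectProperty C :=
  (ObjectProperty.singleton X).triangEnvelopeIter 0

/-- `P` is an indecomposable object of `⟨G⟩₁`. -/
def IsIndAddClosure (G P : C) : Prop :=
  addClosure G P ∧ Indecomposable P

variable (C) in
/-- Every object is a finite direct sum of objects with local endomorphism rings. -/
def IsKrullSchmidt : Prop :=
  ∀ X : C, ∃ (n : ℕ) (f : Fin n → C),
    (∀ i, IsLocalRing (End (f i))) ∧ Nonempty (X ≅ ⨁ f)

variable (k : Type w) [Field k] [Linear k C]

variable (C) in
/-- All morphism spaces are finite-dimensional. -/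
def IsHomFinite : Prop :=
  ∀ X Y : C, FiniteDimensional k (X ⟶ Y)

/-- The relation `Q ≤ P`, meaning that `Hom(P, Q)` is isomorphic to `k`. -/
def HomLE (Q P : C) : Prop :=
  Nonempty ((P ⟶ Q) ≃ₗ[k] k)

/-- `G` is a linear generator. -/
structure IsLinearGenerator (G : C) : Prop where
  /-- `G` is a classical generator: its thick closure is everything. -/
  classical_generator : thickClosure G = ⊤
  /-- The relation `HomLE` is a total order on the isomorphism classes of indecomposable
  objects of `⟨G⟩₁` (this field and the next three). -/
  le_refl : ∀ P : C, IsIndAddClosure G P → HomLE k P P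
  le_trans : ∀ R Q P : C, IsIndAddClosure G R → IsIndAddClosure G Q → IsIndAddClosure G P →
    HomLE k R Q → HomLE k Q P → HomLE k R P
  le_antisymm : ∀ Q P : C, IsIndAddClosure G Q → IsIndAddClosure G P →
    HomLE k Q P → HomLE k P Q → Nonempty (Q ≅ P)
  le_total : ∀ Q P : C, IsIndAddClosure G Q → IsIndAddClosure G P →
    HomLE k Q P ∨ HomLE k P Q
  /-- If `Q < P`, then there is no nonzero morphism from `Q` to `P`. -/
  hom_eq_zero : ∀ Q P : C, IsIndAddClosure G Q → IsIndAddClosure G P →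
    HomLE k Q P → ¬ Nonempty (Q ≅ P) → ∀ f : Q ⟶ P, f = 0
  le_shift : ∀ P : C, IsIndAddClosure G P → HomLE k P (P⟦(1 : ℤ)⟧)
  /-- There is nothing strictly between `P` and `P[1]`. -/
  iso_of_le_of_le_shift : ∀ P Q : C, IsIndAddClosure G P → IsIndAddClosure G Q →
    HomLE k P Q → HomLE k Q (P⟦(1 : ℤ)⟧) →
    Nonempty (Q ≅ P) ∨ Nonempty (Q ≅ P⟦(1 : ℤ)⟧)
  /-- If `R ≤ Q ≤ P`, then every nonzero morphism `P ⟶ R` factors through `Q`. -/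
  factors : ∀ R Q P : C, IsIndAddClosure G R → IsIndAddClosure G Q → IsIndAddClosure G P →
    HomLE k R Q → HomLE k Q P →
    ∀ f : P ⟶ R, f ≠ 0 → ∃ (g : P ⟶ Q) (h : Q ⟶ R), g ≠ 0 ∧ h ≠ 0 ∧ g ≫ h = f

/-- The morphisms `α Y Z`, for `Y` and `Z` indecomposable objects of the full subcategory `S`,
form a choice of generators of the morphism spaces of `S` which is compatible with composition.
(The values of `α` at other objects play no role.) -/
structure IsGeneratorChoice (S : ObjectProperty C) (α : ∀ Y Z : C, Y ⟶ Z) : Prop where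
  /-- `α Y Z` generates the `k`-vector space `Hom(Y, Z)`; thus it is a basis if this space is
  nonzero, and it is zero otherwise. -/
  span_eq_top : ∀ Y Z : C, S Y → S Z → Indecomposable Y → Indecomposable Z →
    Submodule.span k {α Y Z} = ⊤
  /-- `α Y Z` is the composite of `α Y W` and `α W Z` whenever it factors through `W`. -/
  eq_comp : ∀ Y W Z : C, S Y → S W → S Z →
    Indecomposable Y → Indecomposable W → Indecomposable Z →
    (∃ (g : Y ⟶ W) (h : W ⟶ Z), g ≫ h = α Y Z) → α Y Z = α Y W ≫ α W Z

end

/-! ### Families with one-dimensional Homs, and extension of generators within them. -/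

section LinearFamilies

variable {C : Type u} [Category.{v} C] [Preadditive C] (k : Type w) [Field k] [Linear k C]

/-! Let `L` be the class of indecomposables of `⟨G⟩₁`. By the axioms its Homs are at most
one-dimensional, it is totally ordered by nonzero morphisms, and nonzero morphisms have nonzero
composites (`LinFam`). Every indecomposable of the category lies in `L` or is the fiber of a nonzero
noninvertible `T ⟶ d⟦1⟧` in `L` (`elem_of_indecomposable`): the cone of a morphism from an object of
`L` to a direct sum of such objects is again such a sum (`FinSum.cone`), so these sums survive the
extensions that build the thick closure, and retracts are controlled by Krull–Schmidt.

Given triangles `d ⟶ Y ⟶ T` and `d' ⟶ Z ⟶ T'`, a morphism `Y ⟶ Z` either has nonzero composite with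
`Z ⟶ T'`, or factors as `Y ⟶ T ⟶ d' ⟶ Z`. The two kinds exclude each other (`Pres.not_both`), so Hom
is at most one-dimensional. Once generators `x` are chosen on `L`, the first kind is normalised to
be `x` on the tops `T`, `T'`, and the second to be `Y ⟶ T ⟶ d' ⟶ Z` scaled by some `c d'`. The only
delicate composite is one of the second kind followed by one of the first: there `c` must absorb the
failure of `x` to commute with the shift. That failure is a cocycle on a total order, hence the
coboundary of some `l` (`LinFam.exists_shift_scalars`), and `c = κ * l` works for every `κ ≠ 0`.

For (2), `x` is extended from the subfamily `L'` of `G'`, and `κ` is read off from the given `α`. It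
is well defined, because comparing fibers along morphisms between them shows that they all yield the
same constant (`NormFiber.exists_constant`). Part (1) is the case of empty `L'`. -/

/-- A family of nonzero objects whose morphism spaces have dimension at most one, which is
totally ordered by the existence of nonzero morphisms, and which is closed under shifts. -/
structure LinFam [HasShift C ℤ] (L : ObjectProperty C) : Prop where
  shift : ∀ (n : ℤ) ⦃P : C⦄, L P → L (P⟦n⟧)
  not_isZero : ∀ ⦃P : C⦄, L P → ¬ IsZero P
  exists_smul : ∀ ⦃P Q : C⦄, L P → L Q → ∀ f g : P ⟶ Q, f ≠ 0 → ∃ s : k, g = s • f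
  comp_ne_zero : ∀ ⦃P Q R : C⦄, L P → L Q → L R → ∀ (f : P ⟶ Q) (g : Q ⟶ R),
    f ≠ 0 → g ≠ 0 → f ≫ g ≠ 0
  total : ∀ ⦃P Q : C⦄, L P → L Q → (∃ f : P ⟶ Q, f ≠ 0) ∨ (∃ f : Q ⟶ P, f ≠ 0)
  down : ∀ ⦃P : C⦄, L P → ∃ f : P⟦(1 : ℤ)⟧ ⟶ P, f ≠ 0

/-- A choice of generators of the morphism spaces between the objects of `S` such that the
nonzero composites of generators are generators. -/
structure IsChoice (S : ObjectProperty C) (α : ∀ Y Z : C, Y ⟶ Z) : Prop where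
  span : ∀ ⦃Y Z : C⦄, S Y → S Z → ∀ f : Y ⟶ Z, ∃ s : k, f = s • α Y Z
  comp : ∀ ⦃Y W Z : C⦄, S Y → S W → S Z → α Y W ≫ α W Z ≠ 0 → α Y W ≫ α W Z = α Y Z

variable {k}

lemma IsChoice.mono {S S' : ObjectProperty C} {α : ∀ Y Z : C, Y ⟶ Z} (h : IsChoice k S α)
    (h' : S' ≤ S) : IsChoice k S' α where
  span _ _ hY hZ := h.span (h' _ hY) (h' _ hZ)
  comp _ _ _ hY hW hZ := h.comp (h' _ hY) (h' _ hW) (h' _ hZ)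

lemma IsChoice.ne_zero {S : ObjectProperty C} {α : ∀ Y Z : C, Y ⟶ Z} (h : IsChoice k S α)
    {Y Z : C} (hY : S Y) (hZ : S Z) {f : Y ⟶ Z} (hf : f ≠ 0) : α Y Z ≠ 0 := by
  rintro h0
  obtain ⟨s, rfl⟩ := h.span hY hZ f
  simp [h0] at hf

lemma IsChoice.exists_smul_eq {S : ObjectProperty C} {α : ∀ Y Z : C, Y ⟶ Z}
    (h : IsChoice k S α) {Y Z : C} (hY : S Y) (hZ : S Z) {f : Y ⟶ Z} (hf : f ≠ 0) :
    ∃ s : k, s ≠ 0 ∧ α Y Z = s • f := by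
  obtain ⟨s, hs⟩ := h.span hY hZ f
  have hs0 : s ≠ 0 := by rintro rfl; simp at hs; exact hf hs
  exact ⟨s⁻¹, inv_ne_zero hs0, by rw [hs, smul_smul, inv_mul_cancel₀ hs0, one_smul]⟩

/-- The generator is `s • 𝟙 Y` with `s ≠ 0`; its nonzero square must again be the generator, so `s *
s = s`. -/
lemma IsChoice.id_eq {S : ObjectProperty C} {α : ∀ Y Z : C, Y ⟶ Z} (h : IsChoice k S α)
    {Y : C} (hY : S Y) (h0 : ¬ IsZero Y) : α Y Y = 𝟙 Y := by
  have h1 : 𝟙 Y ≠ 0 := fun e => h0 ((IsZero.iff_id_eq_zero Y).2 e)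
  obtain ⟨s, hs, e⟩ := h.exists_smul_eq hY hY h1
  have h2 : α Y Y ≫ α Y Y = (s * s) • 𝟙 Y := by rw [e]; simp [smul_smul]
  have h3 := h.comp hY hY hY (by
    rw [h2]; exact smul_ne_zero (mul_ne_zero hs hs) h1)
  rw [h2, e] at h3
  have h4 : s * s = s := smul_left_injective k h1 h3
  have : s = 1 := by simpa [hs] using h4
  rw [e, this, one_smul]

variable [HasShift C ℤ]

lemma LinFam.mono {L L' : ObjectProperty C} (h : LinFam k L) (h' : L' ≤ L)
    (hs : ∀ (n : ℤ) ⦃P : C⦄, L' P → L' (P⟦n⟧)) : LinFam k L' where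
  shift := hs
  not_isZero _ hP := h.not_isZero (h' _ hP)
  exists_smul _ _ hP hQ := h.exists_smul (h' _ hP) (h' _ hQ)
  comp_ne_zero _ _ _ hP hQ hR := h.comp_ne_zero (h' _ hP) (h' _ hQ) (h' _ hR)
  total _ _ hP hQ := h.total (h' _ hP) (h' _ hQ)
  down _ hP := h.down (h' _ hP)

/-- In a linear family, the composites of generators are nonzero. -/
lemma IsChoice.comp_eq {L : ObjectProperty C} {x : ∀ Y Z : C, Y ⟶ Z} (h : IsChoice k L x)
    (hL : LinFam k L) {P Q R : C} (hP : L P) (hQ : L Q) (hR : L R) (h1 : x P Q ≠ 0)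
    (h2 : x Q R ≠ 0) : x P Q ≫ x Q R = x P R :=
  h.comp hP hQ hR (hL.comp_ne_zero hP hQ hR _ _ h1 h2)

/-- A generator choice on a subfamily of a linear family extends to the family. -/
lemma LinFam.exists_isChoice {L L' : ObjectProperty C} (hL : LinFam k L) (h' : L' ≤ L)
    {α : ∀ Y Z : C, Y ⟶ Z} (hα : IsChoice k L' α) :
    ∃ x : ∀ Y Z : C, Y ⟶ Z, IsChoice k L x ∧ ∀ Y Z : C, L' Y → L' Z → x Y Z = α Y Z := by
  classical
  by_cases hne : ∃ o, L o
  swap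
  · exact ⟨α, ⟨fun Y _ hY => (hne ⟨Y, hY⟩).elim, fun Y _ _ hY => (hne ⟨Y, hY⟩).elim⟩,
      fun _ _ _ _ => rfl⟩
  -- Anchoring at a point of `L'`, when there is one, is what makes the normalised choice restrict
  -- to `α`.
  obtain ⟨o, ho, ho'⟩ : ∃ o, L o ∧ ((∃ P, L' P) → L' o) := by
    by_cases h1 : ∃ P, L' P
    · obtain ⟨P, hP⟩ := h1
      exact ⟨P, h' _ hP, fun _ => hP⟩
    · obtain ⟨o, ho⟩ := hne
      exact ⟨o, ho, fun h => (h1 h).elim⟩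
  -- an arbitrary choice of generators
  have hx0 : ∀ P Q : C, ∃ f : P ⟶ Q, (L P → L Q → ∀ g : P ⟶ Q, ∃ s : k, g = s • f) ∧
      (L' P → L' Q → f = α P Q) := by
    intro P Q
    by_cases h1 : L' P ∧ L' Q
    · exact ⟨α P Q, fun _ _ g => hα.span h1.1 h1.2 g, fun _ _ => rfl⟩
    · by_cases h2 : ∃ f : P ⟶ Q, f ≠ 0
      · obtain ⟨f, hf⟩ := h2
        exact ⟨f, fun hP hQ g => hL.exists_smul hP hQ f g hf, fun a b => (h1 ⟨a, b⟩).elim⟩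
      · push Not at h2
        exact ⟨0, fun _ _ g => ⟨0, by simp [h2 g]⟩, fun a b => (h1 ⟨a, b⟩).elim⟩
  choose x0 hspan hx0α using hx0
  have hnz : ∀ {P Q : C}, L P → L Q → ∀ f : P ⟶ Q, f ≠ 0 → x0 P Q ≠ 0 := by
    intro P Q hP hQ f hf h0
    obtain ⟨s, rfl⟩ := hspan P Q hP hQ f
    simp [h0] at hf
  -- `a` is above the base point
  let U : C → Prop := fun a => x0 a o ≠ 0
  have hD : ∀ {a}, L a → ¬ U a → x0 o a ≠ 0 := by
    intro a ha hU
    rcases hL.total ha ho with ⟨f, hf⟩ | ⟨f, hf⟩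
    · exact (hU (hnz ha ho f hf)).elim
    · exact hnz ho ha f hf
  -- Each generator is chosen so that its triangle with `o` commutes. All other compatibilities then
  -- follow by cancelling nonzero morphisms.
  have hx : ∀ P Q : C, ∃ f : P ⟶ Q, (L P → L Q → x0 P Q ≠ 0 → f ≠ 0) ∧
      (L P → L Q → x0 P Q ≠ 0 →
        (U P → U Q → f ≫ x0 Q o = x0 P o) ∧ (U P → ¬ U Q → f = x0 P o ≫ x0 o Q) ∧
        (¬ U P → ¬ U Q → x0 o P ≫ f = x0 o Q)) ∧ (L P → L Q → x0 P Q = 0 → f = 0) := by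
    intro P Q
    by_cases hPQ : L P ∧ L Q ∧ x0 P Q ≠ 0
    swap
    · exact ⟨0, fun a b c => (hPQ ⟨a, b, c⟩).elim, fun a b c => (hPQ ⟨a, b, c⟩).elim,
        fun _ _ _ => rfl⟩
    obtain ⟨hP, hQ, h0⟩ := hPQ
    by_cases hUP : U P
    · by_cases hUQ : U Q
      · obtain ⟨s, hs⟩ := hL.exists_smul hP ho _ (x0 P o)
          (hL.comp_ne_zero hP hQ ho (x0 P Q) (x0 Q o) h0 hUQ)
        have hs0 : s ≠ 0 := by rintro rfl; simp at hs; exact hUP hs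
        exact ⟨s • x0 P Q, fun _ _ _ => smul_ne_zero hs0 h0, fun _ _ _ =>
          ⟨fun _ _ => by rw [Linear.smul_comp, ← hs], fun _ h => (h hUQ).elim,
            fun h => (h hUP).elim⟩, fun _ _ h => (h0 h).elim⟩
      · exact ⟨x0 P o ≫ x0 o Q, fun _ _ _ => hL.comp_ne_zero hP ho hQ _ _ hUP (hD hQ hUQ),
          fun _ _ _ => ⟨fun _ h => (hUQ h).elim, fun _ _ => rfl, fun h => (h hUP).elim⟩,
          fun _ _ h => (h0 h).elim⟩
    · have hUQ : ¬ U Q := fun h => hUP (hnz hP ho _ (hL.comp_ne_zero hP hQ ho _ _ h0 h))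
      obtain ⟨s, hs⟩ := hL.exists_smul ho hQ _ (x0 o Q)
        (hL.comp_ne_zero ho hP hQ (x0 o P) (x0 P Q) (hD hP hUP) h0)
      have hs0 : s ≠ 0 := by rintro rfl; simp at hs; exact hD hQ hUQ hs
      exact ⟨s • x0 P Q, fun _ _ _ => smul_ne_zero hs0 h0, fun _ _ _ =>
          ⟨fun h => (hUP h).elim, fun h => (hUP h).elim, fun _ _ => by
            rw [Linear.comp_smul, ← hs]⟩, fun _ _ h => (h0 h).elim⟩
  choose x hx1 hx2 hx3 using hx
  have hxx : ∀ {P Q : C}, L P → L Q → x P Q ≠ 0 → x0 P Q ≠ 0 :=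
    fun hP hQ h h0 => h (hx3 _ _ hP hQ h0)
  have hcancel_right : ∀ {P Q R : C}, L P → L Q → L R → ∀ (f g : P ⟶ Q) (h : Q ⟶ R), h ≠ 0 →
      f ≫ h = g ≫ h → f = g := by
    intro P Q R hP hQ hR f g h hh e
    by_contra hne
    exact hL.comp_ne_zero hP hQ hR (f - g) h (sub_ne_zero.2 hne) hh (by simp [e])
  have hcancel_left : ∀ {P Q R : C}, L P → L Q → L R → ∀ (f g : Q ⟶ R) (h : P ⟶ Q), h ≠ 0 →
      h ≫ f = h ≫ g → f = g := by
    intro P Q R hP hQ hR f g h hh e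
    by_contra hne
    exact hL.comp_ne_zero hP hQ hR h (f - g) hh (sub_ne_zero.2 hne) (by simp [e])
  refine ⟨x, ⟨fun P Q hP hQ f => ?_, fun P Q R hP hQ hR h => ?_⟩, fun P Q hP hQ => ?_⟩
  · by_cases h0 : x0 P Q = 0
    · obtain ⟨s, hs⟩ := hspan P Q hP hQ f
      exact ⟨0, by rw [hs, h0]; simp⟩
    · exact hL.exists_smul hP hQ _ f (hx1 _ _ hP hQ h0)
  · have h1 : x P Q ≠ 0 := fun e => h (by simp [e])
    have h2 : x Q R ≠ 0 := fun e => h (by simp [e])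
    have h3 : x0 P R ≠ 0 := hnz hP hR _ h
    obtain ⟨a1, a2, a3⟩ := hx2 _ _ hP hQ (hxx hP hQ h1)
    obtain ⟨b1, b2, b3⟩ := hx2 _ _ hQ hR (hxx hQ hR h2)
    obtain ⟨c1, c2, c3⟩ := hx2 _ _ hP hR h3
    by_cases hUR : U R
    · have hUQ : U Q := hnz hQ ho _ (hL.comp_ne_zero hQ hR ho _ _ h2 hUR)
      have hUP : U P := hnz hP ho _ (hL.comp_ne_zero hP hQ ho _ _ h1 hUQ)
      apply hcancel_right hP hR ho _ _ _ hUR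
      rw [Category.assoc, b1 hUQ hUR, a1 hUP hUQ, c1 hUP hUR]
    · by_cases hUQ : U Q
      · have hUP : U P := hnz hP ho _ (hL.comp_ne_zero hP hQ ho _ _ h1 hUQ)
        rw [b2 hUQ hUR, c2 hUP hUR, ← a1 hUP hUQ, Category.assoc]
      · by_cases hUP : U P
        · rw [a2 hUP hUQ, c2 hUP hUR, Category.assoc, b3 hUQ hUR]
        · apply hcancel_left ho hP hR _ _ _ (hD hP hUP)
          rw [← Category.assoc, a3 hUP hUQ, b3 hUQ hUR, c3 hUP hUR]
  · have hP' := h' _ hP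
    have hQ' := h' _ hQ
    have hoL : L' o := ho' ⟨P, hP⟩
    have e0 := hx0α P Q hP hQ
    by_cases h0 : x0 P Q = 0
    · rw [hx3 _ _ hP' hQ' h0, ← e0, h0]
    obtain ⟨a1, a2, a3⟩ := hx2 _ _ hP' hQ' h0
    -- On `L'` the given `α` solves the same normalising equations, since `o` lies in `L'`.
    have key : ∀ {A B D : C}, L' A → L' B → L' D → x0 A B ≠ 0 → x0 B D ≠ 0 →
        x0 A B ≫ x0 B D = x0 A D := by
      intro A B D hA hB hD' h1 h2
      have := hL.comp_ne_zero (h' _ hA) (h' _ hB) (h' _ hD') _ _ h1 h2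
      rw [hx0α _ _ hA hB, hx0α _ _ hB hD'] at this ⊢
      rw [hx0α _ _ hA hD']
      exact hα.comp hA hB hD' this
    rw [← e0]
    by_cases hUP : U P
    · by_cases hUQ : U Q
      · apply hcancel_right hP' hQ' ho _ _ _ hUQ
        rw [a1 hUP hUQ, key hP hQ hoL h0 hUQ]
      · rw [a2 hUP hUQ, key hP hoL hQ hUP (hD hQ' hUQ)]
    · have hUQ : ¬ U Q := fun h => hUP (hnz hP' ho _ (hL.comp_ne_zero hP' hQ' ho _ _ h0 h))
      apply hcancel_left ho hP' hQ' _ _ _ (hD hP' hUP)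
      rw [a3 hUP hUQ, key hoL hP hQ (hD hP' hUP) h0]

end LinearFamilies

/-! ### Comparing generators with their shifts. -/

section ShiftScalars

variable {C : Type u} [Category.{v} C] [Preadditive C] [HasShift C ℤ]
  [∀ n : ℤ, (shiftFunctor C n).Additive]
  {k : Type w} [Field k] [Linear k C]

lemma shift_map_ne_zero {X Y : C} {f : X ⟶ Y} (hf : f ≠ 0) (n : ℤ) : f⟦n⟧' ≠ 0 := by
  intro h
  exact hf ((shiftFunctor C n).map_injective (by rw [h, Functor.map_zero]))

/-- A generator choice is compatible with the shift up to a coboundary. -/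
lemma LinFam.exists_shift_scalars {L : ObjectProperty C} (hL : LinFam k L)
    {x : ∀ Y Z : C, Y ⟶ Z} (hx : IsChoice k L x) :
    ∃ l : C → k, (∀ a, l a ≠ 0) ∧ ∀ a b : C, L a → L b → x a b ≠ 0 →
      l a • x (a⟦(1 : ℤ)⟧) (b⟦(1 : ℤ)⟧) = l b • (x a b)⟦(1 : ℤ)⟧' := by
  classical
  by_cases hne : ∃ o, L o
  swap
  · exact ⟨fun _ => 1, fun _ => one_ne_zero, fun a _ ha => (hne ⟨a, ha⟩).elim⟩
  obtain ⟨o, ho⟩ := hne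
  have hm : ∀ a b : C, ∃ m : k, m ≠ 0 ∧ (L a → L b → x a b ≠ 0 →
      x (a⟦(1 : ℤ)⟧) (b⟦(1 : ℤ)⟧) = m • (x a b)⟦(1 : ℤ)⟧') := by
    intro a b
    by_cases h : L a ∧ L b ∧ x a b ≠ 0
    · obtain ⟨m, hm0, hm⟩ := hx.exists_smul_eq (hL.shift 1 h.1) (hL.shift 1 h.2.1)
        (shift_map_ne_zero h.2.2 1)
      exact ⟨m, hm0, fun _ _ _ => hm⟩
    · exact ⟨1, one_ne_zero, fun a b c => (h ⟨a, b, c⟩).elim⟩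
  choose m hm0 hm using hm
  have hmul : ∀ {a b c : C}, L a → L b → L c → x a b ≠ 0 → x b c ≠ 0 →
      m a b * m b c = m a c := by
    intro a b c ha hb hc hab hbc
    have hac : x a b ≫ x b c = x a c := hx.comp_eq hL ha hb hc hab hbc
    have hac0 : x a c ≠ 0 := hac ▸ hL.comp_ne_zero ha hb hc _ _ hab hbc
    have e1 := hm a b ha hb hab
    have e2 := hm b c hb hc hbc
    have e3 := hm a c ha hc hac0
    have hne : ∀ {P Q : C}, L P → L Q → x P Q ≠ 0 → x (P⟦(1 : ℤ)⟧) (Q⟦(1 : ℤ)⟧) ≠ 0 :=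
      fun hP hQ h => hx.ne_zero (hL.shift 1 hP) (hL.shift 1 hQ) (shift_map_ne_zero h 1)
    have e4 := hx.comp_eq hL (hL.shift 1 ha) (hL.shift 1 hb) (hL.shift 1 hc)
      (hne ha hb hab) (hne hb hc hbc)
    rw [e1, e2, e3, Linear.smul_comp, Linear.comp_smul, ← Functor.map_comp, hac, smul_smul] at e4
    exact smul_left_injective k (shift_map_ne_zero hac0 1) e4
  -- By `hmul`, `m` is a multiplicative cocycle; its values against the base point `o`, inverted
  -- above `o`, give a potential for it.
  refine ⟨fun a => if x a o ≠ 0 then (m a o)⁻¹ else m o a, fun a => ?_, fun a b ha hb hab => ?_⟩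
  · dsimp only
    split_ifs
    · exact inv_ne_zero (hm0 _ _)
    · exact hm0 _ _
  · have hD : ∀ {a}, L a → ¬ x a o ≠ 0 → x o a ≠ 0 := by
      intro a ha hU
      rcases hL.total ha ho with ⟨f, hf⟩ | ⟨f, hf⟩
      · exact (hU (hx.ne_zero ha ho hf)).elim
      · exact hx.ne_zero ho ha hf
    rw [hm a b ha hb hab, smul_smul]
    congr 1
    dsimp only
    have ha0 := hm0 a o
    have hb0 := hm0 b o
    by_cases hUb : x b o ≠ 0
    · have hUa : x a o ≠ 0 := hx.ne_zero ha ho (hL.comp_ne_zero ha hb ho _ _ hab hUb)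
      have := hmul ha hb ho hab hUb
      rw [if_pos hUa, if_pos hUb, ← this]
      field_simp [hm0]
    · by_cases hUa : x a o ≠ 0
      · rw [if_pos hUa, if_neg hUb, ← hmul ha ho hb hUa (hD hb hUb)]
        field_simp
      · rw [if_neg hUa, if_neg hUb, hmul ho ha hb (hD ha hUa) hab]

end ShiftScalars

/-! ### Fibers of morphisms in the family, and the two kinds of morphisms between them. -/

section Presentations

variable {C : Type u} [Category.{v} C] [Preadditive C] [HasZeroObject C] [HasShift C ℤ]
  [∀ n : ℤ, (shiftFunctor C n).Additive] [Pretriangulated C]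

/-- `Y` is the fiber of a nonzero morphism `T ⟶ d⟦1⟧` between objects of `L` such that there is
no nonzero morphism in the other direction. -/
def IsFiber (L : ObjectProperty C) (Y : C) : Prop :=
  ∃ (d T : C) (i : d ⟶ Y) (p : Y ⟶ T) (w : T ⟶ d⟦(1 : ℤ)⟧), L d ∧ L T ∧ w ≠ 0 ∧
    (∀ g : d⟦(1 : ℤ)⟧ ⟶ T, g = 0) ∧ Triangle.mk i p w ∈ distTriang C

/-- The objects of `L` and the fibers of morphisms between them. -/
def Elem (L : ObjectProperty C) : ObjectProperty C :=
  fun Y => L Y ∨ IsFiber L Y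

/-- A presentation of `Y` as an object of `L` (if `d` is zero) or as the fiber of a generator
between objects of `L`. -/
structure Pres (L : ObjectProperty C) (x : ∀ Y Z : C, Y ⟶ Z) (Y : C) where
  {d T : C}
  i : d ⟶ Y
  p : Y ⟶ T
  dist : Triangle.mk i p (x T (d⟦(1 : ℤ)⟧)) ∈ distTriang C
  hT : L T
  hd : L d ∨ IsZero d
  ne_zero : L d → x T (d⟦(1 : ℤ)⟧) ≠ 0
  eq_zero : L d → ∀ g : d⟦(1 : ℤ)⟧ ⟶ T, g = 0

lemma IsFiber.mono {L L' : ObjectProperty C} (h : L' ≤ L) {Y : C} (hY : IsFiber L' Y) :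
    IsFiber L Y := by
  obtain ⟨d, T, i, p, w, hd, hT, r⟩ := hY
  exact ⟨d, T, i, p, w, h _ hd, h _ hT, r⟩

lemma Elem.mono {L L' : ObjectProperty C} (h : L' ≤ L) : Elem L' ≤ Elem L :=
  fun _ hY => hY.imp (h _) (IsFiber.mono h)

lemma distinguished_of_iso {X Y Z X' Y' Z' : C} {f : X ⟶ Y} {g : Y ⟶ Z}
    {h : Z ⟶ X⟦(1 : ℤ)⟧} {f' : X' ⟶ Y'} {g' : Y' ⟶ Z'} {h' : Z' ⟶ X'⟦(1 : ℤ)⟧}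
    (hT : Triangle.mk f g h ∈ distTriang C) (e₁ : X' ≅ X) (e₂ : Y' ≅ Y) (e₃ : Z' ≅ Z)
    (c₁ : f' ≫ e₂.hom = e₁.hom ≫ f) (c₂ : g' ≫ e₃.hom = e₂.hom ≫ g)
    (c₃ : h' ≫ e₁.hom⟦(1 : ℤ)⟧' = e₃.hom ≫ h) : Triangle.mk f' g' h' ∈ distTriang C :=
  isomorphic_distinguished _ hT _ (Triangle.isoMk _ _ e₁ e₂ e₃ c₁ c₂ c₃)

/-- A distinguished triangle remains distinguished when its morphisms are multiplied by scalars
with product one. -/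
lemma distinguished_smul {k : Type w} [Field k] [Linear k C] {X Y Z : C} {f : X ⟶ Y} {g : Y ⟶ Z}
    {h : Z ⟶ X⟦(1 : ℤ)⟧} (hT : Triangle.mk f g h ∈ distTriang C) (a b c : k) (e : a * b * c = 1) :
    Triangle.mk (a • f) (b • g) (c • h) ∈ distTriang C := by
  have ha : a ≠ 0 := by rintro rfl; simp at e
  have hb : b ≠ 0 := by rintro rfl; simp at e
  have hc : c ≠ 0 := by rintro rfl; simp at e
  refine distinguished_of_iso hT (Iso.refl X)
    ⟨a⁻¹ • 𝟙 Y, a • 𝟙 Y, by simp [smul_smul, ha], by simp [smul_smul, ha]⟩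
    ⟨c • 𝟙 Z, c⁻¹ • 𝟙 Z, by simp [smul_smul, hc], by simp [smul_smul, hc]⟩ ?_ ?_ ?_
  · simp [smul_smul, ha]
  · have : c * b = a⁻¹ := by field_simp; linear_combination e
    simp [smul_smul, this]
  · simp

variable {k : Type w} [Field k] [Linear k C]

section Exactness

variable {d Y T Q : C} {i : d ⟶ Y} {p : Y ⟶ T} {w : T ⟶ d⟦(1 : ℤ)⟧}

lemma dist_comp₁₂ (h : Triangle.mk i p w ∈ distTriang C) : i ≫ p = 0 :=
  comp_distTriang_mor_zero₁₂ _ h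

lemma dist_comp₂₃ (h : Triangle.mk i p w ∈ distTriang C) : p ≫ w = 0 :=
  comp_distTriang_mor_zero₂₃ _ h

lemma dist_comp₃₁ (h : Triangle.mk i p w ∈ distTriang C) : w ≫ i⟦(1 : ℤ)⟧' = 0 :=
  comp_distTriang_mor_zero₃₁ _ h

lemma dist_desc₂ (h : Triangle.mk i p w ∈ distTriang C) (f : Y ⟶ Q) (hf : i ≫ f = 0) :
    ∃ g : T ⟶ Q, f = p ≫ g :=
  Triangle.yoneda_exact₂ _ h f hf

lemma dist_desc₃ (h : Triangle.mk i p w ∈ distTriang C) (f : T ⟶ Q) (hf : p ≫ f = 0) :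
    ∃ g : d⟦(1 : ℤ)⟧ ⟶ Q, f = w ≫ g :=
  Triangle.yoneda_exact₃ _ h f hf

lemma dist_lift₂ (h : Triangle.mk i p w ∈ distTriang C) (f : Q ⟶ Y) (hf : f ≫ p = 0) :
    ∃ g : Q ⟶ d, f = g ≫ i :=
  Triangle.coyoneda_exact₂ _ h f hf

lemma dist_lift₁ (h : Triangle.mk i p w ∈ distTriang C) (f : Q ⟶ d⟦(1 : ℤ)⟧)
    (hf : f ≫ i⟦(1 : ℤ)⟧' = 0) : ∃ g : Q ⟶ T, f = g ≫ w :=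
  Triangle.coyoneda_exact₁ _ h f hf

end Exactness

/-- If `w ≠ 0`, then every morphism from the fiber of `w` to an object of `L` factors
through `p`. -/
lemma LinFam.fiber_desc {L : ObjectProperty C} (hL : LinFam k L) {d Y T Q : C} {i : d ⟶ Y}
    {p : Y ⟶ T} {w : T ⟶ d⟦(1 : ℤ)⟧} (h : Triangle.mk i p w ∈ distTriang C) (hd : L d) (hT : L T)
    (hw : w ≠ 0) (hQ : L Q) (f : Y ⟶ Q) : ∃ g : T ⟶ Q, f = p ≫ g := by
  refine dist_desc₂ h f ?_
  by_contra hne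
  -- If `i ≫ f` were nonzero, so would be `w ≫ (i ≫ f)⟦1⟧'`, against `w ≫ i⟦1⟧' = 0`.
  refine hL.comp_ne_zero hT (hL.shift 1 hd) (hL.shift 1 hQ) w _ hw (shift_map_ne_zero hne 1) ?_
  rw [Functor.map_comp, ← Category.assoc, dist_comp₃₁ h, zero_comp]

/-- If `w ≠ 0`, then every morphism from an object of `L` to the fiber of `w` factors
through `i`. -/
lemma LinFam.fiber_lift {L : ObjectProperty C} (hL : LinFam k L) {d Y T Q : C} {i : d ⟶ Y}
    {p : Y ⟶ T} {w : T ⟶ d⟦(1 : ℤ)⟧} (h : Triangle.mk i p w ∈ distTriang C) (hd : L d) (hT : L T)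
    (hw : w ≠ 0) (hQ : L Q) (f : Q ⟶ Y) : ∃ g : Q ⟶ d, f = g ≫ i := by
  refine dist_lift₂ h f ?_
  by_contra hne
  refine hL.comp_ne_zero hQ hT (hL.shift 1 hd) _ w hne hw ?_
  rw [Category.assoc, dist_comp₂₃ h, comp_zero]

namespace Pres

variable {L : ObjectProperty C} {x : ∀ Y Z : C, Y ⟶ Z} {Y Z : C}

lemma desc (P : Pres L x Y) (hL : LinFam k L) {Q : C} (hQ : L Q) (f : Y ⟶ Q) :
    ∃ g : P.T ⟶ Q, f = P.p ≫ g := by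
  rcases P.hd with hd | hd
  · exact hL.fiber_desc P.dist hd P.hT (P.ne_zero hd) hQ f
  · exact dist_desc₂ P.dist f (hd.eq_of_src _ _)

/-- Morphisms to objects of `L` are multiples of the canonical one. -/
lemma exists_smul (P : Pres L x Y) (hL : LinFam k L) (hx : IsChoice k L x) {Q : C} (hQ : L Q)
    (f : Y ⟶ Q) : ∃ s : k, f = s • (P.p ≫ x P.T Q) := by
  obtain ⟨g, rfl⟩ := P.desc hL hQ f
  obtain ⟨s, rfl⟩ := hx.span P.hT hQ g
  exact ⟨s, by simp⟩

/-- Exactness: what `P.p` kills factors through the connecting morphism, so nothing nonzero is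
killed when `P.d` is zero. -/
lemma kernel (P : Pres L x Y) {Q : C} (g : P.T ⟶ Q) (hg : g ≠ 0) (hpg : P.p ≫ g = 0) :
    L P.d ∧ ∃ h : P.d⟦(1 : ℤ)⟧ ⟶ Q, h ≠ 0 ∧ g = x P.T (P.d⟦(1 : ℤ)⟧) ≫ h := by
  obtain ⟨h, rfl⟩ := dist_desc₃ P.dist g hpg
  have h0 : h ≠ 0 := by rintro rfl; simp at hg
  refine ⟨P.hd.resolve_right fun hz => h0 ?_, h, h0, rfl⟩
  exact ((shiftFunctor C (1 : ℤ)).map_isZero hz).eq_of_src _ _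

/-- The connecting morphism followed by `h` is nonzero, hence spans `P.T ⟶ Q`, and `P.p` kills it.
-/
lemma kernel' (P : Pres L x Y) (hL : LinFam k L) {Q : C} (hQ : L Q) (hd : L P.d)
    (h : P.d⟦(1 : ℤ)⟧ ⟶ Q) (h0 : h ≠ 0) (g : P.T ⟶ Q) : P.p ≫ g = 0 := by
  obtain ⟨s, rfl⟩ := hL.exists_smul P.hT hQ _ g
    (hL.comp_ne_zero P.hT (hL.shift 1 hd) hQ _ _ (P.ne_zero hd) h0)
  rw [Linear.comp_smul, ← Category.assoc, dist_comp₂₃ P.dist, zero_comp, smul_zero]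

lemma p_ne_zero (P : Pres L x Y) (hL : LinFam k L) : P.p ≠ 0 := by
  intro h
  obtain ⟨hd, g, hg, -⟩ := P.kernel (𝟙 P.T)
    (fun e => hL.not_isZero P.hT ((IsZero.iff_id_eq_zero _).2 e)) (by simp [h])
  exact hg (P.eq_zero hd g)

lemma i_ne_zero (P : Pres L x Y) (hd : L P.d) : P.i ≠ 0 := by
  intro h
  obtain ⟨g, hg⟩ := dist_lift₁ P.dist (𝟙 _) (by simp [h])
  rw [P.eq_zero hd g, zero_comp] at hg
  apply P.ne_zero hd
  rw [← Category.comp_id (x P.T (P.d⟦(1 : ℤ)⟧)), hg, comp_zero]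

/-- If a morphism `Y ⟶ Z` is nonzero on the tops, then it is also given by a nonzero morphism
on the other ends, provided that `Z` is a fiber. -/
lemma exists_hom_of_type_a (P : Pres L x Y) (R : Pres L x Z) (hL : LinFam k L)
    (hx : IsChoice k L x) (f : Y ⟶ Z) (hf : f ≫ R.p ≠ 0) (hR : L R.d) :
    L P.d ∧ x (P.d⟦(1 : ℤ)⟧) (R.d⟦(1 : ℤ)⟧) ≠ 0 ∧ x P.T R.T ≫ x R.T (R.d⟦(1 : ℤ)⟧) =
      x P.T (P.d⟦(1 : ℤ)⟧) ≫ x (P.d⟦(1 : ℤ)⟧) (R.d⟦(1 : ℤ)⟧) := by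
  obtain ⟨s, hs⟩ := P.exists_smul hL hx R.hT (f ≫ R.p)
  have hs0 : s ≠ 0 := by rintro rfl; simp at hs; exact hf hs
  have hx0 : x P.T R.T ≠ 0 := by intro e; simp [e] at hs; exact hf hs
  have h1 : P.p ≫ x P.T R.T ≫ x R.T (R.d⟦(1 : ℤ)⟧) = 0 := by
    have : s • (P.p ≫ x P.T R.T) ≫ x R.T (R.d⟦(1 : ℤ)⟧) = 0 := by
      rw [← Linear.smul_comp, ← hs, Category.assoc, dist_comp₂₃ R.dist, comp_zero]
    rw [← Category.assoc]
    exact (smul_eq_zero.1 this).resolve_left hs0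
  have h2 := hL.comp_ne_zero P.hT R.hT (hL.shift 1 hR) _ _ hx0 (R.ne_zero hR)
  obtain ⟨hP, h, h0, -⟩ := P.kernel _ h2 h1
  have h3 := hx.ne_zero (hL.shift 1 hP) (hL.shift 1 hR) h0
  refine ⟨hP, h3, ?_⟩
  rw [hx.comp_eq hL P.hT R.hT (hL.shift 1 hR) hx0 (R.ne_zero hR),
    hx.comp_eq hL P.hT (hL.shift 1 hP) (hL.shift 1 hR) (P.ne_zero hP) h3]

/-- There cannot be both a morphism which is nonzero on the tops, and a nonzero morphism which
factors through the top of the source. -/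
lemma not_both (P : Pres L x Y) (R : Pres L x Z) (hL : LinFam k L)
    (hx : IsChoice k L x) (f : Y ⟶ Z) (hf : f ≫ R.p ≠ 0) :
    P.p ≫ x P.T R.d ≫ R.i = 0 := by
  rcases R.hd with hR | hR
  swap
  · rw [hR.eq_of_tgt (x P.T R.d) 0]; simp
  obtain ⟨hP, h, -⟩ := P.exists_hom_of_type_a R hL hx f hf hR
  -- The nonzero chain `P.d⟦1⟧ ⟶ R.d⟦1⟧ ⟶ R.d` makes every `P.T ⟶ R.d` factor through the connecting
  -- morphism.
  obtain ⟨g, hg⟩ := hL.down hR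
  rw [← Category.assoc, P.kernel' hL hR hP _
    (hL.comp_ne_zero (hL.shift 1 hP) (hL.shift 1 hR) hR _ _ h hg), zero_comp]

end Pres

end Presentations

/-! ### The scalar that a given choice of generators attaches to a fiber. -/

section Generators

variable {C : Type u} [Category.{v} C] [Preadditive C] [HasZeroObject C] [HasShift C ℤ]
  [∀ n : ℤ, (shiftFunctor C n).Additive] [Pretriangulated C]
  {k : Type w} [Field k] [Linear k C]

lemma exists_hom_fiber {X Y Z X' Y' Z' : C} {f : X ⟶ Y} {g : Y ⟶ Z}
    {h : Z ⟶ X⟦(1 : ℤ)⟧} {f' : X' ⟶ Y'} {g' : Y' ⟶ Z'} {h' : Z' ⟶ X'⟦(1 : ℤ)⟧}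
    (hT : Triangle.mk f g h ∈ distTriang C) (hT' : Triangle.mk f' g' h' ∈ distTriang C)
    (a : X ⟶ X') (c : Z ⟶ Z') (e : h ≫ a⟦(1 : ℤ)⟧' = c ≫ h') :
    ∃ b : Y ⟶ Y', f ≫ b = a ≫ f' ∧ g ≫ c = b ≫ g' :=
  complete_distinguished_triangle_morphism₂ _ _ hT hT' a c e

/-- The morphism of fibers induced by generators. -/
lemma exists_fiber_hom [∀ n : ℤ, (shiftFunctor C n).Linear k] {x : ∀ Y Z : C, Y ⟶ Z} {l : C → k}
    {Y Z d T d' T' : C}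
    {i : d ⟶ Y} {p : Y ⟶ T} {i' : d' ⟶ Z} {p' : Z ⟶ T'}
    (h : Triangle.mk i p (x T (d⟦(1 : ℤ)⟧)) ∈ distTriang C)
    (h' : Triangle.mk i' p' (x T' (d'⟦(1 : ℤ)⟧)) ∈ distTriang C) (hl : l d ≠ 0)
    (hx : l d • x (d⟦(1 : ℤ)⟧) (d'⟦(1 : ℤ)⟧) = l d' • (x d d')⟦(1 : ℤ)⟧')
    (e : x T T' ≫ x T' (d'⟦(1 : ℤ)⟧) =
      x T (d⟦(1 : ℤ)⟧) ≫ x (d⟦(1 : ℤ)⟧) (d'⟦(1 : ℤ)⟧)) :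
    ∃ f : Y ⟶ Z, l d • (i ≫ f) = l d' • (x d d' ≫ i') ∧ f ≫ p' = p ≫ x T T' := by
  -- The generator between the shifts is the shift of a rescaled `x d d'`; this is the factor that
  -- the fibers have to absorb.
  have h1 : x (d⟦(1 : ℤ)⟧) (d'⟦(1 : ℤ)⟧) = (((l d)⁻¹ * l d') • x d d')⟦(1 : ℤ)⟧' := by
    rw [Functor.map_smul, mul_smul, ← hx, smul_smul, inv_mul_cancel₀ hl, one_smul]
  obtain ⟨f, h2, h3⟩ := exists_hom_fiber h h' (((l d)⁻¹ * l d') • x d d') (x T T')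
    (by rw [e, h1])
  refine ⟨f, ?_, h3.symm⟩
  rw [h2, Linear.smul_comp, smul_smul, mul_inv_cancel_left₀ hl]

/-- A presentation of `Y` as the fiber of a generator such that the projection is the given
generator, and the inclusion is the given generator up to the scalar `ν`. -/
structure NormFiber (L : ObjectProperty C) (α : ∀ Y Z : C, Y ⟶ Z) (Y d T : C) (ν : k) : Prop where
  hd : L d
  hT : L T
  hY : Elem L Y
  ne_zero : α T (d⟦(1 : ℤ)⟧) ≠ 0
  eq_zero : ∀ g : d⟦(1 : ℤ)⟧ ⟶ T, g = 0
  dist : ∃ i : d ⟶ Y, α d Y = ν • i ∧ Triangle.mk i (α Y T) (α T (d⟦(1 : ℤ)⟧)) ∈ distTriang C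

variable {L : ObjectProperty C} {α : ∀ Y Z : C, Y ⟶ Z}

lemma le_elem (L : ObjectProperty C) : L ≤ Elem L := fun _ h => Or.inl h

/-- Scaling the morphisms of a triangle so that the connecting morphism is a generator. -/
lemma LinFam.exists_smul_distinguished (hL : LinFam k L) (hα : IsChoice k L α) {Y d T : C}
    {i : d ⟶ Y} {p : Y ⟶ T} {w : T ⟶ d⟦(1 : ℤ)⟧} (hd : L d) (hT : L T) (hw : w ≠ 0)
    (h : Triangle.mk i p w ∈ distTriang C) :
    ∃ i' : d ⟶ Y, Triangle.mk i' p (α T (d⟦(1 : ℤ)⟧)) ∈ distTriang C := by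
  obtain ⟨s, hs, e⟩ := hα.exists_smul_eq hT (hL.shift 1 hd) hw
  have := distinguished_smul h s⁻¹ 1 s (by field_simp)
  rw [one_smul, ← e] at this
  exact ⟨_, this⟩

/-- A triangle may be rescaled only by factors of product one. Making `w` and `p` generators uses up
this freedom, and `ν` records the defect left on `i`. -/
lemma NormFiber.of_dist (hL : LinFam k L) (hα : IsChoice k (Elem L) α) {Y d T : C}
    {i : d ⟶ Y} {p : Y ⟶ T} {w : T ⟶ d⟦(1 : ℤ)⟧} (hd : L d) (hT : L T) (hw : w ≠ 0)
    (hw' : ∀ g : d⟦(1 : ℤ)⟧ ⟶ T, g = 0)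
    (h : Triangle.mk i p w ∈ distTriang C) : ∃ ν : k, NormFiber L α Y d T ν := by
  have hY : Elem L Y := Or.inr ⟨_, _, _, _, _, hd, hT, hw, hw', h⟩
  have hαL := hα.mono (le_elem L)
  obtain ⟨i, h⟩ := hL.exists_smul_distinguished hαL hd hT hw h
  have hne := hαL.ne_zero hT (hL.shift 1 hd) hw
  let P : Pres L α Y := ⟨i, p, h, hT, Or.inl hd, fun _ => hne, fun _ => hw'⟩
  obtain ⟨b, hb, e⟩ := hα.exists_smul_eq hY (Or.inl hT) (P.p_ne_zero hL)
  have h2 := distinguished_smul h b⁻¹ b 1 (by field_simp)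
  change α Y T = b • p at e
  rw [one_smul, ← e] at h2
  obtain ⟨s, hs, e'⟩ := hα.exists_smul_eq (Or.inl hd) hY
    (smul_ne_zero (inv_ne_zero hb) (P.i_ne_zero hd) : b⁻¹ • i ≠ 0)
  exact ⟨s, hd, hT, hY, hne, hw', _, e', h2⟩

section Constant

variable [∀ n : ℤ, (shiftFunctor C n).Linear k] (hL : LinFam k L) (hα : IsChoice k (Elem L) α)
  {l : C → k} (hl : ∀ a, l a ≠ 0)
  (hl' : ∀ a b : C, L a → L b → α a b ≠ 0 →
    l a • α (a⟦(1 : ℤ)⟧) (b⟦(1 : ℤ)⟧) = l b • (α a b)⟦(1 : ℤ)⟧')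

include hL hα hl hl'

/-- The morphism of fibers induced by generators is a generator on the tops, hence equals `α Y Z`,
while on first terms it is off by `l d' / l d`. Computing `α d Z` through `Y` and through `d'` gives
the relation; `h0` keeps the composites nonzero. -/
lemma NormFiber.scalar_eq {Y Z d T d' T' : C} {ν ν' : k} (hY : NormFiber L α Y d T ν)
    (hZ : NormFiber L α Z d' T' ν') (hTT : α T T' ≠ 0) (hdd : α d d' ≠ 0)
    (h0 : ∀ g : d⟦(1 : ℤ)⟧ ⟶ T', g = 0) : ν * l d' = ν' * l d := by
  have hαL := hα.mono (le_elem L)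
  have hdd1 : α (d⟦(1 : ℤ)⟧) (d'⟦(1 : ℤ)⟧) ≠ 0 :=
    hαL.ne_zero (hL.shift 1 hY.hd) (hL.shift 1 hZ.hd) (shift_map_ne_zero hdd 1)
  obtain ⟨i, hi, hdY⟩ := hY.dist
  obtain ⟨i', hi', hdZ⟩ := hZ.dist
  let P : Pres L α Y := ⟨i, _, hdY, hY.hT, Or.inl hY.hd, fun _ => hY.ne_zero, fun _ => hY.eq_zero⟩
  obtain ⟨f, hf1, hf2⟩ := exists_fiber_hom hdY hdZ (hl d) (hl' _ _ hY.hd hZ.hd hdd) (by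
    rw [hαL.comp_eq hL hY.hT hZ.hT (hL.shift 1 hZ.hd) hTT hZ.ne_zero,
      hαL.comp_eq hL hY.hT (hL.shift 1 hY.hd) (hL.shift 1 hZ.hd) hY.ne_zero hdd1])
  have hne : α Y T ≫ α T T' ≠ 0 := by
    intro e
    obtain ⟨-, g, hg, -⟩ := P.kernel (α T T') hTT e
    exact hg (h0 g)
  have hfα : f = α Y Z := by
    obtain ⟨s, hs⟩ := hα.span hY.hY hZ.hY f
    have e1 := hα.comp hY.hY (Or.inl hY.hT) (Or.inl hZ.hT) hne
    rw [← hf2, hs, Linear.smul_comp] at hne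
    have e2 := hα.comp hY.hY hZ.hY (Or.inl hZ.hT) (smul_ne_zero_iff.1 hne).2
    rw [e1, hs, Linear.smul_comp, e2] at hf2
    have h3 : α Y T' ≠ 0 := e2 ▸ (smul_ne_zero_iff.1 hne).2
    have : s = 1 := smul_left_injective k h3 (by simpa using hf2)
    rw [hs, this, one_smul]
  have hdi : α d d' ≫ i' ≠ 0 := by
    intro e
    obtain ⟨g, hg⟩ := dist_lift₁ hdZ ((α d d')⟦(1 : ℤ)⟧') (by
      rw [← Functor.map_comp, e, Functor.map_zero])
    rw [h0 g, zero_comp] at hg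
    exact shift_map_ne_zero hdd 1 hg
  have hif : i ≫ f ≠ 0 := by
    intro e
    rw [e, smul_zero] at hf1
    exact smul_ne_zero (hl d') hdi hf1.symm
  have hν : ν ≠ 0 := by
    rintro rfl
    rw [zero_smul] at hi
    exact hα.ne_zero (Or.inl hY.hd) hY.hY (P.i_ne_zero hY.hd) hi
  have hν' : ν' ≠ 0 := by
    rintro rfl
    rw [zero_smul] at hi'
    exact hα.ne_zero (Or.inl hZ.hd) hZ.hY (f := i') (fun e => hdi (by rw [e, comp_zero])) hi'
  have e1 : α d Y ≫ α Y Z = α d Z := hα.comp (Or.inl hY.hd) hY.hY hZ.hY (by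
    rw [hi, ← hfα, Linear.smul_comp]
    exact smul_ne_zero hν hif)
  have e2 : α d d' ≫ α d' Z = α d Z := hα.comp (Or.inl hY.hd) (Or.inl hZ.hd) hZ.hY (by
    rw [hi', Linear.comp_smul]
    exact smul_ne_zero hν' hdi)
  rw [← e2, hi, ← hfα, hi', Linear.smul_comp, Linear.comp_smul] at e1
  have e3 : (ν * l d') • (α d d' ≫ i') = (ν' * l d) • (α d d' ≫ i') := by
    rw [mul_smul, ← hf1, smul_comm, e1, mul_comm, mul_smul]
  exact smul_left_injective k hdi e3

/-- The tops may be ordered the wrong way, or there may be a nonzero `d⟦1⟧ ⟶ T'`. So `Y` and `Z` are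
compared through a fiber `M` sharing one end with each: of `T ⟶ d'⟦1⟧` if there is a nonzero `T ⟶
T'`, else of `T' ⟶ d⟦1⟧`. -/
lemma NormFiber.scalar_eq_of_le {Y Z d T d' T' : C} {ν ν' : k} (hY : NormFiber L α Y d T ν)
    (hZ : NormFiber L α Z d' T' ν') (hdd : α d d' ≠ 0) : ν * l d' = ν' * l d := by
  have hαL := hα.mono (le_elem L)
  have hdd1 : α (d⟦(1 : ℤ)⟧) (d'⟦(1 : ℤ)⟧) ≠ 0 :=
    hαL.ne_zero (hL.shift 1 hY.hd) (hL.shift 1 hZ.hd) (shift_map_ne_zero hdd 1)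
  have hid : ∀ {a : C}, L a → α a a ≠ 0 := fun {a} ha =>
    hαL.ne_zero ha ha (f := 𝟙 a) (fun e => hL.not_isZero ha ((IsZero.iff_id_eq_zero _).2 e))
  rcases hL.total hY.hT hZ.hT with ⟨t, ht⟩ | ⟨t, ht⟩
  · have hTT := hαL.ne_zero hY.hT hZ.hT ht
    have hw := hL.comp_ne_zero hY.hT (hL.shift 1 hY.hd) (hL.shift 1 hZ.hd) _ _ hY.ne_zero hdd1
    have hw' : ∀ g : d'⟦(1 : ℤ)⟧ ⟶ T, g = 0 := fun g => by
      by_contra hg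
      exact hL.comp_ne_zero (hL.shift 1 hY.hd) (hL.shift 1 hZ.hd) hY.hT _ _ hdd1 hg
        (hY.eq_zero _)
    obtain ⟨M, i, p, hM⟩ := distinguished_cocone_triangle₂
      (α T (d⟦(1 : ℤ)⟧) ≫ α (d⟦(1 : ℤ)⟧) (d'⟦(1 : ℤ)⟧))
    obtain ⟨μ, hμ⟩ := NormFiber.of_dist hL hα hZ.hd hY.hT hw hw' hM
    have e1 := hY.scalar_eq hL hα hl hl' hμ (hid hY.hT) hdd hY.eq_zero
    have e2 := hμ.scalar_eq hL hα hl hl' hZ hTT (hid hZ.hd) hZ.eq_zero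
    have e3 : μ = ν' := mul_right_cancel₀ (hl d') e2
    rw [e1, e3]
  · have hw := hL.comp_ne_zero hZ.hT hY.hT (hL.shift 1 hY.hd) _ _ ht hY.ne_zero
    have hw' : ∀ g : d⟦(1 : ℤ)⟧ ⟶ T', g = 0 := fun g => by
      by_contra hg
      exact hL.comp_ne_zero (hL.shift 1 hY.hd) hZ.hT hY.hT _ _ hg ht (hY.eq_zero _)
    obtain ⟨M, i, p, hM⟩ := distinguished_cocone_triangle₂ (t ≫ α T (d⟦(1 : ℤ)⟧))
    obtain ⟨μ, hμ⟩ := NormFiber.of_dist hL hα hY.hd hZ.hT hw hw' hM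
    have e1 := hμ.scalar_eq hL hα hl hl' hY (hαL.ne_zero hZ.hT hY.hT ht) (hid hY.hd) hY.eq_zero
    have e2 := hμ.scalar_eq hL hα hl hl' hZ (hid hZ.hT) hdd hw'
    rw [← e2, mul_right_cancel₀ (hl d) e1]

/-- The scalars of normalized fibers are proportional to `l`. -/
lemma NormFiber.exists_constant : ∃ κ : k, κ ≠ 0 ∧ ∀ (Y d T : C) (ν : k),
    NormFiber L α Y d T ν → ν = κ * l d := by
  have hαL := hα.mono (le_elem L)
  by_cases h : ∃ (Y d T : C) (ν : k), NormFiber L α Y d T ν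
  swap
  · exact ⟨1, one_ne_zero, fun Y d T ν h' => (h ⟨Y, d, T, ν, h'⟩).elim⟩
  obtain ⟨Y, d, T, ν, hY⟩ := h
  have hν : ν ≠ 0 := by
    rintro rfl
    obtain ⟨i, hi, h⟩ := hY.dist
    let P : Pres L α Y := ⟨i, _, h, hY.hT, Or.inl hY.hd, fun _ => hY.ne_zero, fun _ => hY.eq_zero⟩
    exact hα.ne_zero (Or.inl hY.hd) hY.hY (P.i_ne_zero hY.hd) (by simpa using hi)
  refine ⟨ν / l d, div_ne_zero hν (hl d), fun Z d' T' ν' hZ => ?_⟩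
  have hd := hl d
  have : ν * l d' = ν' * l d := by
    rcases hL.total hY.hd hZ.hd with ⟨f, hf⟩ | ⟨f, hf⟩
    · exact hY.scalar_eq_of_le hL hα hl hl' hZ (hαL.ne_zero hY.hd hZ.hd hf)
    · exact (hZ.scalar_eq_of_le hL hα hl hl' hY (hαL.ne_zero hZ.hd hY.hd hf)).symm
  field_simp
  exact this.symm

end Constant

end Generators

/-! ### Normalised generators between fibers, and the extension theorem. -/

section Extension

variable {C : Type u} [Category.{v} C] [Preadditive C] [HasZeroObject C] [HasShift C ℤ]
  [∀ n : ℤ, (shiftFunctor C n).Additive] [Pretriangulated C]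
  {k : Type w} [Field k] [Linear k C]
  {L : ObjectProperty C} {x : ∀ Y Z : C, Y ⟶ Z}

namespace Pres

variable {Y W Z : C}

/-- `b` is compatible with the generator between the tops if there is a morphism which is
nonzero on the tops; otherwise `b` is the composite `P.p ≫ x P.T R.d ≫ j`. -/
def IsGen (P : Pres L x Y) (R : Pres L x Z) (j : R.d ⟶ Z) (b : Y ⟶ Z) : Prop :=
  (b ≫ R.p = P.p ≫ x P.T R.T ∧ b ≫ R.p ≠ 0) ∨
    ((∀ f : Y ⟶ Z, f ≫ R.p = 0) ∧ b = P.p ≫ x P.T R.d ≫ j)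

variable (hL : LinFam k L) (hx : IsChoice k L x)

include hL hx

lemma exists_isGen (P : Pres L x Y) (R : Pres L x Z) (j : R.d ⟶ Z) : ∃ b, P.IsGen R j b := by
  by_cases h : ∃ f : Y ⟶ Z, f ≫ R.p ≠ 0
  · obtain ⟨f, hf⟩ := h
    obtain ⟨s, hs⟩ := P.exists_smul hL hx R.hT (f ≫ R.p)
    have hs0 : s ≠ 0 := by rintro rfl; rw [zero_smul] at hs; exact hf hs
    refine ⟨s⁻¹ • f, Or.inl ⟨?_, ?_⟩⟩
    · rw [Linear.smul_comp, hs, smul_smul, inv_mul_cancel₀ hs0, one_smul]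
    · rw [Linear.smul_comp]
      exact smul_ne_zero (inv_ne_zero hs0) hf
  · push Not at h
    exact ⟨_, Or.inr ⟨h, rfl⟩⟩

/-- Morphisms which vanish on the tops. -/
lemma exists_smul_of_comp_eq_zero (P : Pres L x Y) (R : Pres L x Z) (f : Y ⟶ Z)
    (hf : f ≫ R.p = 0) : ∃ s : k, f = s • (P.p ≫ x P.T R.d ≫ R.i) := by
  obtain ⟨g, rfl⟩ := dist_lift₂ R.dist f hf
  rcases R.hd with hd | hd
  · obtain ⟨s, rfl⟩ := P.exists_smul hL hx hd g
    exact ⟨s, by simp⟩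
  · exact ⟨0, by rw [hd.eq_of_tgt g 0]; simp⟩

/-- If `b` is nonzero on the tops, subtracting a multiple of `b` from `f` kills the top, and
`not_both` leaves no room for the remainder. -/
lemma IsGen.span {P : Pres L x Y} {R : Pres L x Z} {c : k} (hc : c ≠ 0) {b : Y ⟶ Z}
    (hb : P.IsGen R (c • R.i) b) (f : Y ⟶ Z) : ∃ s : k, f = s • b := by
  rcases hb with ⟨hb, hb0⟩ | ⟨h0, rfl⟩
  · obtain ⟨s, hs⟩ := P.exists_smul hL hx R.hT (f ≫ R.p)
    refine ⟨s, ?_⟩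
    obtain ⟨t, ht⟩ := P.exists_smul_of_comp_eq_zero hL hx R (f - s • b) (by
      rw [Preadditive.sub_comp, Linear.smul_comp, hs, hb, sub_self])
    rw [P.not_both R hL hx b hb0, smul_zero] at ht
    exact sub_eq_zero.1 ht
  · obtain ⟨s, hs⟩ := P.exists_smul_of_comp_eq_zero hL hx R f (h0 f)
    exact ⟨s * c⁻¹, by simp [hs, smul_smul, hc]⟩

/-- A morphism which is a generator on the tops is also compatible with the inclusions. -/
lemma IsGen.comm [∀ n : ℤ, (shiftFunctor C n).Linear k] {l : C → k} (hl : ∀ a, l a ≠ 0)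
    (hl' : ∀ a b : C, L a → L b → x a b ≠ 0 →
      l a • x (a⟦(1 : ℤ)⟧) (b⟦(1 : ℤ)⟧) = l b • (x a b)⟦(1 : ℤ)⟧')
    (P : Pres L x Y) (R : Pres L x Z) {b : Y ⟶ Z}
    (hb : b ≫ R.p = P.p ≫ x P.T R.T) (hb0 : b ≫ R.p ≠ 0) :
    l P.d • (P.i ≫ b) = l R.d • (x P.d R.d ≫ R.i) := by
  rcases R.hd with hd | hd
  · obtain ⟨hP, h1, h2⟩ := P.exists_hom_of_type_a R hL hx b hb0 hd
    obtain ⟨g, hg⟩ := (shiftFunctor C (1 : ℤ)).map_surjective (x (P.d⟦(1 : ℤ)⟧) (R.d⟦(1 : ℤ)⟧))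
    have h3 : x P.d R.d ≠ 0 := hx.ne_zero hP hd (f := g) (by
      rintro rfl
      rw [Functor.map_zero] at hg
      exact h1 hg.symm)
    obtain ⟨f, hf1, hf2⟩ := exists_fiber_hom P.dist R.dist (hl _) (hl' _ _ hP hd h3) h2
    have hgen : P.IsGen R ((1 : k) • R.i) b := Or.inl ⟨hb, hb0⟩
    obtain ⟨s, rfl⟩ := hgen.span hL hx one_ne_zero f
    rw [Linear.smul_comp, ← hb] at hf2
    have : s = 1 := smul_left_injective k hb0 (by simpa using hf2)
    rw [← hf1, this, one_smul]
  · rw [hd.eq_of_tgt (x P.d R.d) 0, zero_comp, smul_zero]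
    obtain ⟨g, hg⟩ := dist_lift₂ R.dist (P.i ≫ b) (by
      rw [Category.assoc, hb, ← Category.assoc, dist_comp₁₂ P.dist, zero_comp])
    rw [hg, hd.eq_of_tgt g 0, zero_comp, smul_zero]

/-- When only `b` is nonzero on the tops, `IsGen.comm` converts the factor `κ * l Q.d` into `κ * l
R.d`: this is why the scalars have this form. When neither is, the composite contains `Q.i ≫ Q.p =
0`. -/
lemma IsGen.comp [∀ n : ℤ, (shiftFunctor C n).Linear k] {l : C → k} (hl : ∀ a, l a ≠ 0)
    (hl' : ∀ a b : C, L a → L b → x a b ≠ 0 →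
      l a • x (a⟦(1 : ℤ)⟧) (b⟦(1 : ℤ)⟧) = l b • (x a b)⟦(1 : ℤ)⟧') {κ : k} (hκ : κ ≠ 0)
    {P : Pres L x Y} {Q : Pres L x W} {R : Pres L x Z} {a : Y ⟶ W} {b : W ⟶ Z} {c : Y ⟶ Z}
    (ha : P.IsGen Q ((κ * l Q.d) • Q.i) a) (hb : Q.IsGen R ((κ * l R.d) • R.i) b)
    (hc : P.IsGen R ((κ * l R.d) • R.i) c) (h : a ≫ b ≠ 0) : a ≫ b = c := by
  have hR0 : κ * l R.d ≠ 0 := mul_ne_zero hκ (hl _)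
  have hc' : P.p ≫ x P.T R.d ≫ ((κ * l R.d) • R.i) ≠ 0 →
      c = P.p ≫ x P.T R.d ≫ ((κ * l R.d) • R.i) := by
    intro h0
    rcases hc with ⟨-, hc0⟩ | ⟨-, hc⟩
    · refine (h0 ?_).elim
      have := P.not_both R hL hx c hc0
      simp [this]
    · exact hc
  have hLR : P.p ≫ x P.T R.d ≫ ((κ * l R.d) • R.i) ≠ 0 → L R.d := fun h0 =>
    R.hd.resolve_right fun hd => h0 (by rw [hd.eq_of_tgt (x P.T R.d) 0]; simp)
  rcases ha with ⟨ha, ha0⟩ | ⟨-, rfl⟩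
  · have hx1 : x P.T Q.T ≠ 0 := fun e => ha0 (by rw [ha, e, comp_zero])
    rcases hb with ⟨hb, hb0⟩ | ⟨-, rfl⟩
    · have hx2 : x Q.T R.T ≠ 0 := fun e => hb0 (by rw [hb, e, comp_zero])
      have hx3 := hx.comp_eq hL P.hT Q.hT R.hT hx1 hx2
      have e : (a ≫ b) ≫ R.p = P.p ≫ x P.T R.T := by
        rw [Category.assoc, hb, ← Category.assoc, ha, Category.assoc, hx3]
      -- If the top vanished, `a ≫ b` would factor through `P.T ⟶ R.d`; but the nonzero chain
      -- `P.d⟦1⟧ ⟶ Q.d⟦1⟧ ⟶ R.d⟦1⟧ ⟶ R.d` forces such composites to vanish.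
      by_cases h0 : (a ≫ b) ≫ R.p = 0
      · exfalso
        obtain ⟨s, hs⟩ := P.exists_smul_of_comp_eq_zero hL hx R _ h0
        have hR : L R.d := R.hd.resolve_right fun hd => h (by
          rw [hs, hd.eq_of_tgt (x P.T R.d) 0]; simp)
        obtain ⟨hQ, hQ1, -⟩ := Q.exists_hom_of_type_a R hL hx b hb0 hR
        obtain ⟨hP, hP1, -⟩ := P.exists_hom_of_type_a Q hL hx a ha0 hQ
        obtain ⟨g, hg⟩ := hL.down hR
        have hg' := hL.comp_ne_zero (hL.shift 1 hQ) (hL.shift 1 hR) hR _ _ hQ1 hg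
        have hg'' := hL.comp_ne_zero (hL.shift 1 hP) (hL.shift 1 hQ) hR _ _ hP1 hg'
        apply h
        rw [hs, ← Category.assoc, P.kernel' hL hR hP _ hg'', zero_comp, smul_zero]
      · rcases hc with ⟨hc, hc0⟩ | ⟨hc, -⟩
        · have hgen : P.IsGen R ((1 : k) • R.i) c := Or.inl ⟨hc, hc0⟩
          obtain ⟨s, hs⟩ := hgen.span hL hx one_ne_zero (a ≫ b)
          rw [hs, Linear.smul_comp, ← hc] at e
          have : s = 1 := smul_left_injective k hc0 (by simpa using e)
          rw [hs, this, one_smul]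
        · exact (h0 (hc _)).elim
    · rw [← Category.assoc, ha, Category.assoc] at h ⊢
      have hx2 : x Q.T R.d ≠ 0 := fun e => h (by rw [e]; simp)
      have hR : L R.d := R.hd.resolve_right fun hd => hx2 (hd.eq_of_tgt _ _)
      rw [← Category.assoc (x P.T Q.T), hx.comp_eq hL P.hT Q.hT hR hx1 hx2] at h ⊢
      exact (hc' h).symm
  · rcases hb with ⟨hb, hb0⟩ | ⟨-, rfl⟩
    · have hcomm := IsGen.comm hL hx hl hl' Q R hb hb0
      have e : (P.p ≫ x P.T Q.d ≫ ((κ * l Q.d) • Q.i)) ≫ b =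
          P.p ≫ (x P.T Q.d ≫ x Q.d R.d) ≫ ((κ * l R.d) • R.i) := by
        simp only [Category.assoc, Linear.smul_comp, Linear.comp_smul, mul_smul]
        simp only [← Linear.comp_smul, hcomm]
      rw [e] at h ⊢
      have hx1 : x P.T Q.d ≠ 0 := fun e => h (by rw [e]; simp)
      have hx2 : x Q.d R.d ≠ 0 := fun e => h (by rw [e]; simp)
      have hR : L R.d := R.hd.resolve_right fun hd => hx2 (hd.eq_of_tgt _ _)
      have hQ : L Q.d := Q.hd.resolve_right fun hd => hx1 (hd.eq_of_tgt _ _)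
      rw [hx.comp_eq hL P.hT hQ hR hx1 hx2] at h ⊢
      exact (hc' h).symm
    · refine (h ?_).elim
      have : Q.i ≫ Q.p = 0 := dist_comp₁₂ Q.dist
      simp [reassoc_of% this]

end Pres

open scoped ZeroObject in
/-- Objects of `Elem L` have presentations; for the objects of `Elem L'`, these are chosen over
`L'` and so that they are compatible with the given generators. -/
lemma Pres.exists_of_elem (hL : LinFam k L) (hx : IsChoice k L x) {L' : ObjectProperty C}
    (hLL : L' ≤ L) (hL' : LinFam k L') {α : ∀ Y Z : C, Y ⟶ Z} (hα : IsChoice k (Elem L') α)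
    (hxα : ∀ Y Z : C, L' Y → L' Z → x Y Z = α Y Z) {l : C → k} {κ : k}
    (hκ : ∀ (Y d T : C) (ν : k), NormFiber L' α Y d T ν → ν = κ * l d) {Y : C}
    (hY : Elem L Y) : ∃ P : Pres L x Y, Elem L' Y → L' P.T ∧ P.p = α Y P.T ∧
      (L P.d → L' P.d ∧ α P.d Y = (κ * l P.d) • P.i) := by
  have triv : ∀ {Y : C}, L Y → ∃ P : Pres L x Y, L' Y → L' P.T ∧ P.p = α Y P.T ∧
      (L P.d → L' P.d ∧ α P.d Y = (κ * l P.d) • P.i) := by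
    intro Y hY
    have hz : ¬ L (0 : C) := fun h => hL.not_isZero h (isZero_zero C)
    refine ⟨⟨0, 𝟙 Y, ?_, hY, Or.inr (isZero_zero C), fun h => (hz h).elim, fun h => (hz h).elim⟩,
      fun h => ⟨h, (hα.id_eq (Or.inl h) (hL'.not_isZero h)).symm, fun h => (hz h).elim⟩⟩
    rw [((shiftFunctor C (1 : ℤ)).map_isZero (isZero_zero C)).eq_of_tgt
      (x Y ((0 : C)⟦(1 : ℤ)⟧)) 0]
    exact contractible_distinguished₁ Y
  by_cases h1 : L' Y
  · obtain ⟨P, hP⟩ := triv (hLL _ h1)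
    exact ⟨P, fun _ => hP h1⟩
  by_cases h2 : IsFiber L' Y
  · obtain ⟨d, T, i, p, w, hd, hT, hw, hw', h⟩ := h2
    obtain ⟨ν, hν⟩ := NormFiber.of_dist hL' hα hd hT hw hw' h
    obtain ⟨i, hi, h⟩ := hν.dist
    have e : x T (d⟦(1 : ℤ)⟧) = α T (d⟦(1 : ℤ)⟧) := hxα _ _ hT (hL'.shift 1 hd)
    exact ⟨⟨i, α Y T, e ▸ h, hLL _ hT, Or.inl (hLL _ hd), fun _ => e ▸ hν.ne_zero,
      fun _ => hν.eq_zero⟩, fun _ => ⟨hT, rfl, fun _ => ⟨hd, hi.trans (congrArg (· • i) (hκ _ _ _ _ hν))⟩⟩⟩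
  have h3 : ¬ Elem L' Y := not_or.2 ⟨h1, h2⟩
  rcases hY with hY | ⟨d, T, i, p, w, hd, hT, hw, hw', h⟩
  · obtain ⟨P, -⟩ := triv hY
    exact ⟨P, fun h => (h3 h).elim⟩
  · obtain ⟨i, h⟩ := hL.exists_smul_distinguished hx hd hT hw h
    exact ⟨⟨i, p, h, hT, Or.inl hd, fun _ => hx.ne_zero hT (hL.shift 1 hd) hw, fun _ => hw'⟩,
      fun h => (h3 h).elim⟩

/-- A generator choice for the objects of `Elem L'` extends to `Elem L`. -/
theorem LinFam.exists_isChoice_elem [∀ n : ℤ, (shiftFunctor C n).Linear k] (hL : LinFam k L)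
    {L' : ObjectProperty C} (hLL : L' ≤ L) (hL' : LinFam k L') {α : ∀ Y Z : C, Y ⟶ Z}
    (hα : IsChoice k (Elem L') α) :
    ∃ β : ∀ Y Z : C, Y ⟶ Z, IsChoice k (Elem L) β ∧
      ∀ Y Z : C, Elem L' Y → Elem L' Z → β Y Z = α Y Z := by
  obtain ⟨x, hx, hxα⟩ := hL.exists_isChoice hLL (hα.mono (le_elem L'))
  obtain ⟨l, hl, hl'⟩ := hL.exists_shift_scalars hx
  obtain ⟨κ, hκ0, hκ⟩ := NormFiber.exists_constant hL' hα hl (fun a b ha hb hab => by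
    rw [← hxα _ _ ha hb, ← hxα _ _ (hL'.shift 1 ha) (hL'.shift 1 hb)]
    exact hl' a b (hLL _ ha) (hLL _ hb) (by rwa [hxα _ _ ha hb]))
  choose P hP using fun (Y : C) (hY : Elem L Y) =>
    Pres.exists_of_elem hL hx hLL hL' hα hxα hκ hY
  have hβ : ∀ Y Z : C, ∃ b : Y ⟶ Z, ∀ (hY : Elem L Y) (hZ : Elem L Z),
      (P Y hY).IsGen (P Z hZ) ((κ * l (P Z hZ).d) • (P Z hZ).i) b := by
    intro Y Z
    by_cases h : Elem L Y ∧ Elem L Z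
    · obtain ⟨b, hb⟩ := (P Y h.1).exists_isGen hL hx (P Z h.2)
        ((κ * l (P Z h.2).d) • (P Z h.2).i)
      exact ⟨b, fun _ _ => hb⟩
    · exact ⟨0, fun hY hZ => (h ⟨hY, hZ⟩).elim⟩
  choose β hβ using hβ
  refine ⟨β, ⟨fun Y Z hY hZ f => ?_, fun Y W Z hY hW hZ h => ?_⟩, fun Y Z hY hZ => ?_⟩
  · exact (hβ Y Z hY hZ).span hL hx (mul_ne_zero hκ0 (hl _)) f
  · exact (hβ Y W hY hW).comp hL hx hl hl' hκ0 (hβ W Z hW hZ) (hβ Y Z hY hZ) h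
  · have hYL := Elem.mono hLL _ hY
    have hZL := Elem.mono hLL _ hZ
    obtain ⟨hT, hp, -⟩ := hP Y hYL hY
    obtain ⟨hT', hp', hd⟩ := hP Z hZL hZ
    obtain ⟨s, hs⟩ := (hβ Y Z hYL hZL).span hL hx (mul_ne_zero hκ0 (hl _)) (α Y Z)
    -- Agreement with `α` is tested after composing into the top of `Z`. In the other case `β Y Z`
    -- is literally a composite of values of `α`, since `κ * l d` is the scalar hidden in `α d Z`.
    rcases hβ Y Z hYL hZL with ⟨hb, hb0⟩ | ⟨-, hb⟩
    · have hα0 : α Y Z ≠ 0 := hα.ne_zero hY hZ (f := β Y Z) (fun e => hb0 (by rw [e, zero_comp]))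
      have hs0 : s ≠ 0 := by rintro rfl; rw [zero_smul] at hs; exact hα0 hs
      have e1 := hα.comp hY hZ (Or.inl hT') (by
        rw [← hp', hs, Linear.smul_comp]; exact smul_ne_zero hs0 hb0)
      have e2 := hα.comp hY (Or.inl hT) (Or.inl hT') (by
        rw [← hp, ← hxα _ _ hT hT', ← hb]; exact hb0)
      rw [← hp, ← hxα _ _ hT hT', ← hb] at e2
      rw [← e2, ← hp', hs, Linear.smul_comp] at e1
      have : s = 1 := smul_left_injective k hb0 (by simpa using e1)
      rw [hs, this, one_smul]
    · by_cases h0 : β Y Z = 0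
      · rw [hs, h0, smul_zero]
      · have hdL : L (P Z hZL).d := (P Z hZL).hd.resolve_right fun hz => h0 (by
          rw [hb, hz.eq_of_tgt (x (P Y hYL).T (P Z hZL).d) 0]; simp)
        obtain ⟨hd', hi⟩ := hd hdL
        rw [← hi, hxα _ _ hT hd', hp] at hb
        have e1 := hα.comp (Or.inl hT) (Or.inl hd') hZ
          (fun e => h0 (by rw [hb, e, comp_zero]))
        rw [hb, e1, hα.comp hY (Or.inl hT) hZ (by rw [← e1, ← hb]; exact h0)]

end Extension

/-! ### Finite direct sums, local endomorphism rings and indecomposability. -/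

section FiniteSums

variable {C : Type u} [Category.{v} C] [Preadditive C] [HasZeroObject C] [HasShift C ℤ]
  [∀ n : ℤ, (shiftFunctor C n).Additive] [Pretriangulated C]

/-- Adding a zero object does not change the other summand. -/
lemma biprod_iso_right_of_isZero (A : C) {B : C} (hA : IsZero A) : Nonempty (B ≅ A ⊞ B) :=
  ⟨⟨biprod.inr, biprod.snd, by simp, by
    apply biprod.hom_ext' <;> simp [hA.eq_of_src biprod.inl 0]⟩⟩

lemma biprod_iso_left_of_isZero {A B : C} (hB : IsZero B) : Nonempty (A ≅ A ⊞ B) :=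
  ⟨⟨biprod.inl, biprod.fst, by simp, by
    apply biprod.hom_ext' <;> simp [hB.eq_of_src biprod.inr 0]⟩⟩

/-- The direct sums of `n` objects satisfying `P`. -/
inductive FinSum (P : ObjectProperty C) : ℕ → C → Prop
  | zero {X : C} (h : IsZero X) : FinSum P 0 X
  | cons {n : ℕ} {X A B : C} (hA : P A) (hB : FinSum P n B) (e : X ≅ A ⊞ B) : FinSum P (n + 1) X

namespace FinSum

variable {P : ObjectProperty C}

lemma of_iso {n : ℕ} {X Y : C} (h : FinSum P n X) (e : Y ≅ X) : FinSum P n Y := by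
  cases h with
  | zero h => exact .zero (h.of_iso e)
  | cons hA hB e' => exact .cons hA hB (e ≪≫ e')

lemma isZero {X : C} (h : FinSum P 0 X) : IsZero X := by
  cases h with
  | zero h => exact h

lemma single {X : C} (h : P X) {Z : C} (hZ : IsZero Z) : FinSum P 1 X :=
  .cons h (.zero hZ) (biprod_iso_left_of_isZero hZ).some

lemma add {n m : ℕ} {X Y : C} (hX : FinSum P n X) (hY : FinSum P m Y) :
    FinSum P (n + m) (X ⊞ Y) := by
  induction hX with
  | zero h => simpa using hY.of_iso (biprod_iso_right_of_isZero _ h).some.symm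
  | cons hA _ e ih =>
    rw [Nat.add_right_comm]
    exact .cons hA ih (biprod.mapIso e (Iso.refl _) ≪≫ biprod.associator _ _ _)

lemma mono {Q : ObjectProperty C} (h : P ≤ Q) {n : ℕ} {X : C} (hX : FinSum P n X) :
    FinSum Q n X := by
  induction hX with
  | zero h => exact .zero h
  | cons hA _ e ih => exact .cons (h _ hA) ih e

/-- The summands of an object of `Q` belong to `Q` if `Q` is stable under retracts. -/
lemma inf_of_retracts (Q : ObjectProperty C) [Q.IsStableUnderRetracts] {n : ℕ} {X : C}
    (hX : FinSum P n X) (h : Q X) : FinSum (P ⊓ Q) n X := by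
  induction hX with
  | zero h0 => exact .zero h0
  | @cons n X A B hA _ e ih =>
    have h1 : Retract A X := ⟨biprod.inl ≫ e.inv, e.hom ≫ biprod.fst, by simp⟩
    have h2 : Retract B X := ⟨biprod.inr ≫ e.inv, e.hom ≫ biprod.snd, by simp⟩
    exact .cons ⟨hA, Q.prop_of_retract h1 h⟩ (ih (Q.prop_of_retract h2 h)) e

lemma biproduct {n : ℕ} (f : Fin n → C) (hf : ∀ i, P (f i)) : FinSum P n (⨁ f) := by
  induction n with
  | zero =>
    refine .zero ((IsZero.iff_id_eq_zero _).2 ?_)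
    ext i
    exact i.elim0
  | succ n ih =>
    refine .cons (hf 0) (ih (fun i => f i.succ) fun i => hf _)
      ⟨biprod.lift (biproduct.π f 0) (biproduct.lift fun i => biproduct.π f i.succ),
        biprod.desc (biproduct.ι f 0) (biproduct.desc fun i => biproduct.ι f i.succ), ?_, ?_⟩
    · apply biproduct.hom_ext'
      intro j
      apply biproduct.hom_ext
      intro j'
      simp only [biprod.lift_desc, Preadditive.comp_add, Preadditive.add_comp,
        biproduct.lift_desc, Preadditive.sum_comp, Preadditive.comp_sum, Category.comp_id]
      trans biproduct.ι f j ≫ (∑ i, biproduct.π f i ≫ biproduct.ι f i) ≫ biproduct.π f j'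
      · simp only [Fin.sum_univ_succ, Preadditive.comp_add, Preadditive.add_comp,
          Preadditive.sum_comp, Preadditive.comp_sum, Category.assoc]
      · rw [biproduct.total, Category.id_comp]
    · apply biprod.hom_ext' <;> apply biprod.hom_ext
      · simp
      · ext j
        simp [biproduct.ι_π_ne _ (Fin.succ_ne_zero j).symm]
      · ext j
        simp [biproduct.ι_π_ne _ (Fin.succ_ne_zero j)]
      · ext j j'
        by_cases h : j = j'
        · subst h
          simp
        · simp [biproduct.ι_π_ne _ (Ne.symm h),
            biproduct.ι_π_ne _ ((Fin.succ_injective n).ne (Ne.symm h))]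

end FinSum

/-- A retract with local endomorphism ring of a direct sum is a retract of one of the summands. -/
lemma FinSum.exists_retract {P : ObjectProperty C} {n : ℕ} {X Y : C} (hX : FinSum P n X)
    (hY : IsLocalRing (End Y)) (r : Retract Y X) : ∃ A, P A ∧ Nonempty (Retract Y A) := by
  induction hX with
  | zero h =>
    exfalso
    have : (1 : End Y) = 0 := by
      change 𝟙 Y = 0
      rw [← r.retract, h.eq_of_tgt r.i 0, zero_comp]
    exact one_ne_zero this
  | @cons n X A B hA _ e ih =>
    let a : End Y := r.i ≫ e.hom ≫ biprod.fst ≫ biprod.inl ≫ e.inv ≫ r.r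
    let b : End Y := r.i ≫ e.hom ≫ biprod.snd ≫ biprod.inr ≫ e.inv ≫ r.r
    have hab : a + b = 1 := by
      change r.i ≫ e.hom ≫ biprod.fst ≫ biprod.inl ≫ e.inv ≫ r.r +
        r.i ≫ e.hom ≫ biprod.snd ≫ biprod.inr ≫ e.inv ≫ r.r = 𝟙 Y
      trans r.i ≫ e.hom ≫ (biprod.fst ≫ biprod.inl + biprod.snd ≫ biprod.inr) ≫ e.inv ≫ r.r
      · simp only [Preadditive.add_comp, Preadditive.comp_add, Category.assoc]
      · rw [biprod.total]
        simp
    rcases hY.isUnit_or_isUnit_of_add_one hab with h | h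
    · rw [isUnit_iff_isIso] at h
      have h' : IsIso (r.i ≫ e.hom ≫ biprod.fst ≫ biprod.inl ≫ e.inv ≫ r.r) := h
      exact ⟨A, hA, ⟨r.i ≫ e.hom ≫ biprod.fst, biprod.inl ≫ e.inv ≫ r.r ≫
        inv (r.i ≫ e.hom ≫ biprod.fst ≫ biprod.inl ≫ e.inv ≫ r.r), by
        have := IsIso.hom_inv_id (r.i ≫ e.hom ≫ biprod.fst ≫ biprod.inl ≫ e.inv ≫ r.r)
        simpa only [Category.assoc] using this⟩⟩
    · rw [isUnit_iff_isIso] at h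
      have h' : IsIso (r.i ≫ e.hom ≫ biprod.snd ≫ biprod.inr ≫ e.inv ≫ r.r) := h
      exact ih ⟨r.i ≫ e.hom ≫ biprod.snd, biprod.inr ≫ e.inv ≫ r.r ≫
        inv (r.i ≫ e.hom ≫ biprod.snd ≫ biprod.inr ≫ e.inv ≫ r.r), by
        have := IsIso.hom_inv_id (r.i ≫ e.hom ≫ biprod.snd ≫ biprod.inr ≫ e.inv ≫ r.r)
        simpa only [Category.assoc] using this⟩

/-- Objects with local endomorphism rings are indecomposable. -/
lemma indecomposable_of_isLocalRing {X : C} (h : IsLocalRing (End X)) : Indecomposable X := by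
  refine ⟨fun hX => one_ne_zero (α := End X) ((IsZero.iff_id_eq_zero X).1 hX), fun Y Z e => ?_⟩
  let a : End X := e.hom ≫ biprod.fst ≫ biprod.inl ≫ e.inv
  let b : End X := e.hom ≫ biprod.snd ≫ biprod.inr ≫ e.inv
  have hab : a + b = 1 := by
    change e.hom ≫ biprod.fst ≫ biprod.inl ≫ e.inv + e.hom ≫ biprod.snd ≫ biprod.inr ≫ e.inv = 𝟙 X
    trans e.hom ≫ (biprod.fst ≫ biprod.inl + biprod.snd ≫ biprod.inr) ≫ e.inv
    · simp only [Preadditive.add_comp, Preadditive.comp_add, Category.assoc]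
    · rw [biprod.total]
      simp
  rcases h.isUnit_or_isUnit_of_add_one hab with h | h
  · right
    rw [isUnit_iff_isIso] at h
    have h' : IsIso (e.hom ≫ biprod.fst ≫ biprod.inl ≫ e.inv) := h
    rw [IsZero.iff_id_eq_zero]
    have h1 : (biprod.inr ≫ e.inv : Z ⟶ X) = 0 := by
      rw [← cancel_mono (e.hom ≫ biprod.fst ≫ biprod.inl ≫ e.inv)]
      simp
    have h2 : 𝟙 Z = (biprod.inr ≫ e.inv) ≫ e.hom ≫ biprod.snd := by simp
    rw [h2, h1, zero_comp]
  · left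
    rw [isUnit_iff_isIso] at h
    have h' : IsIso (e.hom ≫ biprod.snd ≫ biprod.inr ≫ e.inv) := h
    rw [IsZero.iff_id_eq_zero]
    have h1 : (biprod.inl ≫ e.inv : Y ⟶ X) = 0 := by
      rw [← cancel_mono (e.hom ≫ biprod.snd ≫ biprod.inr ≫ e.inv)]
      simp
    have h2 : 𝟙 Y = (biprod.inl ≫ e.inv) ≫ e.hom ≫ biprod.fst := by simp
    rw [h2, h1, zero_comp]

/-- An indecomposable direct sum of objects satisfying `P` is isomorphic to one of them, provided
that the objects satisfying `P` are nonzero. -/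
lemma FinSum.exists_iso_of_indecomposable {P : ObjectProperty C} (hP : ∀ A, P A → ¬ IsZero A)
    {X : C} (hX : Indecomposable X) {n : ℕ} (h : FinSum P n X) :
    ∃ A, P A ∧ Nonempty (X ≅ A) := by
  cases h with
  | zero h => exact (hX.1 h).elim
  | @cons n _ A B hA hB e =>
    have hB0 : IsZero B := (hX.2 _ _ e).resolve_left (hP A hA)
    exact ⟨A, hA, ⟨e ≪≫ (biprod_iso_left_of_isZero hB0).some.symm⟩⟩

end FiniteSums

/-! ### Cones of morphisms from the family to sums of family objects and fibers. -/

section Cones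

variable {C : Type u} [Category.{v} C] [Preadditive C] [HasZeroObject C] [HasShift C ℤ]
  [∀ n : ℤ, (shiftFunctor C n).Additive] [Pretriangulated C]
  {k : Type w} [Field k] [Linear k C] {L : ObjectProperty C}

/-- `i : d ⟶ X` exhibits `X` either as isomorphic to an object `d` of `L` or as a fiber of a
morphism in `L`. -/
def IsHead (L : ObjectProperty C) {X d : C} (i : d ⟶ X) : Prop :=
  L d ∧ ∃ (K : C) (a : X ⟶ K) (b : K ⟶ d⟦(1 : ℤ)⟧), Triangle.mk i a b ∈ distTriang C ∧
    (IsZero K ∨ (L K ∧ b ≠ 0))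

open scoped ZeroObject in
lemma Elem.exists_isHead {X : C} (hX : Elem L X) : ∃ (d : C) (i : d ⟶ X), IsHead L i := by
  rcases hX with hX | ⟨d, T, i, p, w, hd, hT, hw, -, h⟩
  · exact ⟨X, 𝟙 X, hX, 0, 0, 0, contractible_distinguished X, Or.inl (isZero_zero C)⟩
  · exact ⟨d, i, hd, T, p, w, h, Or.inr ⟨hT, hw⟩⟩

lemma IsHead.lift (hL : LinFam k L) {X d q : C} {i : d ⟶ X} (hi : IsHead L i) (hq : L q)
    (f : q ⟶ X) : ∃ u : q ⟶ d, f = u ≫ i := by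
  obtain ⟨hd, K, a, b, h, hK | ⟨hK, hb⟩⟩ := hi
  · exact dist_lift₂ h f (hK.eq_of_tgt _ _)
  · exact hL.fiber_lift h hd hK hb hq f

/-- Interchange of the first two summands. -/
noncomputable def biprodSwap (A B D : C) : A ⊞ (B ⊞ D) ≅ B ⊞ (A ⊞ D) where
  hom := biprod.lift (biprod.snd ≫ biprod.fst) (biprod.map (𝟙 A) biprod.snd)
  inv := biprod.lift (biprod.snd ≫ biprod.fst) (biprod.map (𝟙 B) biprod.snd)
  hom_inv_id := by apply biprod.hom_ext <;> [skip; apply biprod.hom_ext] <;> simp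
  inv_hom_id := by apply biprod.hom_ext <;> [skip; apply biprod.hom_ext] <;> simp

/-- Given a morphism from an object of `L` to a direct sum, we may choose a summand such that
the component at this summand vanishes, or such that the other components factor through it. -/
lemma FinSum.exists_select (hL : LinFam k L) {q : C} (hq : L q) {n : ℕ} {X : C}
    (hX : FinSum (Elem L) (n + 1) X) (f : q ⟶ X) :
    ∃ (A B : C) (e : X ≅ A ⊞ B), FinSum (Elem L) n B ∧
      ((Elem L A ∧ f ≫ e.hom ≫ biprod.fst = 0) ∨ ∃ (d : C) (i : d ⟶ A) (u : q ⟶ d) (g : d ⟶ B),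
        IsHead L i ∧ u ≫ i ≠ 0 ∧ f ≫ e.hom ≫ biprod.fst = u ≫ i ∧
          f ≫ e.hom ≫ biprod.snd = u ≫ g) := by
  induction n generalizing X with
  | zero =>
    cases hX with
    | @cons _ _ A B hA hB e =>
      refine ⟨A, B, e, hB, ?_⟩
      by_cases h0 : f ≫ e.hom ≫ biprod.fst = 0
      · exact Or.inl ⟨hA, h0⟩
      · obtain ⟨d, i, hi⟩ := hA.exists_isHead
        obtain ⟨u, hu⟩ := hi.lift hL hq (f ≫ e.hom ≫ biprod.fst)
        exact Or.inr ⟨d, i, u, 0, hi, hu ▸ h0, hu, hB.isZero.eq_of_tgt _ _⟩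
  | succ n ih =>
    cases hX with
    | @cons _ _ A B hA hB e =>
      by_cases h0 : f ≫ e.hom ≫ biprod.fst = 0
      · exact ⟨A, B, e, hB, Or.inl ⟨hA, h0⟩⟩
      obtain ⟨d, i, hi⟩ := hA.exists_isHead
      obtain ⟨u, hu⟩ := hi.lift hL hq (f ≫ e.hom ≫ biprod.fst)
      obtain ⟨A', B', e', hB', h⟩ := ih hB (f ≫ e.hom ≫ biprod.snd)
      let σ : X ≅ A' ⊞ (A ⊞ B') :=
        e ≪≫ biprod.mapIso (Iso.refl A) e' ≪≫ biprodSwap A A' B'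
      have hσ1 : f ≫ σ.hom ≫ biprod.fst = (f ≫ e.hom ≫ biprod.snd) ≫ e'.hom ≫ biprod.fst := by
        simp [σ, biprodSwap]
      have hσ2 : f ≫ σ.hom ≫ biprod.snd = biprod.lift (f ≫ e.hom ≫ biprod.fst)
          ((f ≫ e.hom ≫ biprod.snd) ≫ e'.hom ≫ biprod.snd) := by
        apply biprod.hom_ext <;> simp [σ, biprodSwap]
      have hs : FinSum (Elem L) (n + 1) (A ⊞ B') := .cons hA hB' (Iso.refl _)
      rcases h with ⟨hA', h'⟩ | ⟨d', i', u', g', hi', hui', h1, h2⟩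
      · exact ⟨A', A ⊞ B', σ, hs, Or.inl ⟨hA', hσ1.trans h'⟩⟩
      have hu0 : u ≠ 0 := by rintro rfl; exact h0 (by rw [hu, zero_comp])
      have hu0' : u' ≠ 0 := by rintro rfl; exact hui' zero_comp
      -- The two heads are comparable. A nonzero `t : d ⟶ d'` makes `u'` a multiple of `u ≫ t`, so
      -- everything factors through `u`; otherwise the roles are exchanged.
      rcases hL.total hi.1 hi'.1 with ⟨t, ht⟩ | ⟨t, ht⟩
      · obtain ⟨s, hs⟩ := hL.exists_smul hq hi'.1 _ u' (hL.comp_ne_zero hq hi.1 hi'.1 u t hu0 ht)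
        refine ⟨A, B, e, hB, Or.inr ⟨d, i, u, (s • t) ≫ biprod.lift i' g' ≫ e'.inv, hi,
          hu ▸ h0, hu, ?_⟩⟩
        rw [← Category.assoc u, Linear.comp_smul, ← hs, ← Category.assoc u', Iso.eq_comp_inv]
        apply biprod.hom_ext
        · simpa using h1
        · simpa using h2
      · obtain ⟨s, hs'⟩ := hL.exists_smul hq hi.1 _ u
          (hL.comp_ne_zero hq hi'.1 hi.1 u' t hu0' ht)
        refine ⟨A', A ⊞ B', σ, hs, Or.inr ⟨d', i', u', biprod.lift ((s • t) ≫ i) g', hi',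
          hui', hσ1.trans h1, ?_⟩⟩
        rw [hσ2]
        apply biprod.hom_ext
        · rw [biprod.lift_fst, Category.assoc, biprod.lift_fst, ← Category.assoc u',
            Linear.comp_smul, ← hs', hu]
        · simpa using h2

lemma biprod_distinguished {X A B : C} (e : X ≅ A ⊞ B) :
    Triangle.mk (biprod.inr ≫ e.inv) (e.hom ≫ biprod.fst) (0 : A ⟶ B⟦(1 : ℤ)⟧) ∈ distTriang C := by
  refine distinguished_of_iso (binaryBiproductTriangle_distinguished B A) (Iso.refl B)
    (e ≪≫ biprod.braiding A B) (Iso.refl A) ?_ ?_ ?_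
  · apply biprod.hom_ext <;> simp
  · simp
  · simp

lemma exists_iso_biprod_of_eq_zero {X Y Z : C} {f : X ⟶ Y} {g : Y ⟶ Z} {h : Z ⟶ X⟦(1 : ℤ)⟧}
    (hT : Triangle.mk f g h ∈ distTriang C) (h0 : h = 0) : Nonempty (Y ≅ X ⊞ Z) := by
  obtain ⟨e, -⟩ := exists_iso_binaryBiproduct_of_distTriang _ hT h0
  exact ⟨e⟩

/-- The cone of a nonzero morphism in `L` is zero or a fiber of a morphism in `L`. -/
lemma LinFam.exists_finSum_cone (hL : LinFam k L) {q d U : C} {u : q ⟶ d} {v : d ⟶ U}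
    {w : U ⟶ q⟦(1 : ℤ)⟧} (hq : L q) (hd : L d) (hu : u ≠ 0)
    (h : Triangle.mk u v w ∈ distTriang C) : ∃ m, FinSum (Elem L) m U := by
  by_cases hg : ∃ g : d ⟶ q, g ≠ 0
  · obtain ⟨g, hg⟩ := hg
    have h1 : 𝟙 q ≠ 0 := fun e => hL.not_isZero hq ((IsZero.iff_id_eq_zero _).2 e)
    have h2 : 𝟙 d ≠ 0 := fun e => hL.not_isZero hd ((IsZero.iff_id_eq_zero _).2 e)
    obtain ⟨s, hs⟩ := hL.exists_smul hq hq _ (𝟙 q) (hL.comp_ne_zero hq hd hq u g hu hg)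
    obtain ⟨t, ht⟩ := hL.exists_smul hd hd _ (𝟙 d) (hL.comp_ne_zero hd hq hd g u hg hu)
    have e1 : u ≫ (s • g) = 𝟙 q := by rw [Linear.comp_smul, ← hs]
    have e2 : (t • g) ≫ u = 𝟙 d := by rw [Linear.smul_comp, ← ht]
    have e3 : t • g = s • g := by
      rw [← Category.comp_id (t • g), ← e1, ← Category.assoc, e2, Category.id_comp]
    have : IsIso u := ⟨s • g, e1, e3 ▸ e2⟩
    exact ⟨0, .zero (Triangle.isZero₃_of_isIso₁ _ h this)⟩
  · push Not at hg
    refine ⟨1, .single (Or.inr ⟨d, q⟦(1 : ℤ)⟧, v, w, -u⟦(1 : ℤ)⟧', hd, hL.shift 1 hq,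
      neg_ne_zero.2 (shift_map_ne_zero hu 1), fun g => ?_, rot_of_distTriang _ h⟩)
      (isZero_zero C)⟩
    obtain ⟨g', rfl⟩ := (shiftFunctor C (1 : ℤ)).map_surjective g
    rw [hg g', Functor.map_zero]

/-- Two inverse rotations exhibit `S` as the cone of a morphism from `K⟦-1⟧`; `X` returns only up to
isomorphism. -/
lemma exists_dist_of_dist {X S K : C} {m : S ⟶ K} {m' : K ⟶ X⟦(1 : ℤ)⟧}
    {m'' : X⟦(1 : ℤ)⟧ ⟶ S⟦(1 : ℤ)⟧} (h : Triangle.mk m m' m'' ∈ distTriang C) :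
    ∃ (X' : C) (f : K⟦(-1 : ℤ)⟧ ⟶ X') (g : X' ⟶ S) (h : S ⟶ (K⟦(-1 : ℤ)⟧)⟦(1 : ℤ)⟧),
      Nonempty (X' ≅ X) ∧ Triangle.mk f g h ∈ distTriang C :=
  ⟨_, _, _, _, ⟨(shiftEquiv C (1 : ℤ)).unitIso.symm.app X⟩,
    inv_rot_of_distTriang _ (inv_rot_of_distTriang _ h)⟩

open Triangulated in
/-- The cone of a morphism from an object of `L` to a direct sum of objects of `Elem L` is again
a direct sum of objects of `Elem L`. -/
lemma FinSum.cone [IsTriangulated C] (hL : LinFam k L) {n : ℕ} {X : C}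
    (hX : FinSum (Elem L) n X) {q Y : C} (hq : L q) {f : q ⟶ X} {v : X ⟶ Y}
    {w : Y ⟶ q⟦(1 : ℤ)⟧} (h : Triangle.mk f v w ∈ distTriang C) :
    ∃ m, FinSum (Elem L) m Y := by
  induction n generalizing X q Y with
  | zero =>
    have : IsIso w := (Triangle.isZero₂_iff_isIso₃ _ h).1 hX.isZero
    have hq1 : FinSum (Elem L) 1 (q⟦(1 : ℤ)⟧) :=
      .single (Or.inl (hL.shift 1 hq)) (isZero_zero C)
    exact ⟨1, hq1.of_iso (@asIso _ _ _ _ w this)⟩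
  | succ n ih =>
    obtain ⟨A, B, e, hB, ⟨hA, h0⟩ | ⟨d, i, u, g, hi, hui, h1, h2⟩⟩ := hX.exists_select hL hq f
    · have hf : (f ≫ e.hom ≫ biprod.snd) ≫ biprod.inr ≫ e.inv = f := by
        rw [← Category.assoc, Iso.comp_inv_eq]
        apply biprod.hom_ext
        · simpa using h0.symm
        · simp
      -- As `f` misses the summand `A`, its cone is `A` plus the cone `U` of the component into `B`.
      obtain ⟨U, v', w', hU⟩ := distinguished_cocone_triangle (f ≫ e.hom ≫ biprod.snd)
      obtain ⟨m, hm⟩ := ih hB hq hU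
      have o := someOctahedron hf hU (biprod_distinguished e) h
      obtain ⟨e'⟩ := exists_iso_biprod_of_eq_zero o.mem zero_comp
      exact ⟨_, (hm.add (.single hA (isZero_zero C))).of_iso e'⟩
    · obtain ⟨hd, K, a, b, hK, hK'⟩ := hi
      have hu : u ≠ 0 := by rintro rfl; exact hui zero_comp
      -- Now `f = u ≫ s`, and the octahedron relates the cones `U`, `Y`, `S` of `u`, `f`, `s`. A
      -- second octahedron presents `S` as an extension of `K` by `B`, which is open to induction.
      let s : d ⟶ X := biprod.lift i g ≫ e.inv
      obtain ⟨S, vs, ws, hS⟩ := distinguished_cocone_triangle s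
      have hsi : s ≫ e.hom ≫ biprod.fst = i := by simp [s]
      obtain ⟨m₁, m₃, m₂, e1, hm₁⟩ : ∃ (m₁ : S ⟶ K) (m₃ : K ⟶ B⟦(1 : ℤ)⟧)
          (m₂ : B⟦(1 : ℤ)⟧ ⟶ S⟦(1 : ℤ)⟧), m₁ ≫ b = ws ∧ Triangle.mk m₁ m₃ m₂ ∈ distTriang C :=
        let o := someOctahedron hsi hS (rot_of_distTriang _ (biprod_distinguished e)) hK
        ⟨o.m₁, o.m₃, _, o.comm₂, o.mem⟩
      have hus : u ≫ s = f := by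
        rw [← Category.assoc, Iso.comp_inv_eq]
        apply biprod.hom_ext
        · simpa using h1.symm
        · simpa using h2.symm
      obtain ⟨U, vu, wu, hU⟩ := distinguished_cocone_triangle u
      let o' := someOctahedron hus hU hS h
      -- `ws` factors through `b`. Either `b` is a multiple of a morphism through `u⟦1⟧'`, which
      -- `vu⟦1⟧'` kills, or `u⟦1⟧'` factors through `b`, contradicting `u ≫ i ≠ 0`. Hence `Y` splits
      -- as `U ⊞ S`.
      have hzero : ws ≫ vu⟦(1 : ℤ)⟧' = 0 := by
        rw [← e1]
        rcases hK' with hK' | ⟨hK', hb⟩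
        · rw [hK'.eq_of_tgt m₁ 0, zero_comp, zero_comp]
        · rcases hL.total hK' (hL.shift 1 hq) with ⟨t, ht⟩ | ⟨t, ht⟩
          · obtain ⟨c, hc⟩ := hL.exists_smul hK' (hL.shift 1 hd) _ b
              (hL.comp_ne_zero hK' (hL.shift 1 hq) (hL.shift 1 hd) t (u⟦(1 : ℤ)⟧') ht
                (shift_map_ne_zero hu 1))
            rw [hc, Linear.comp_smul, Linear.smul_comp, Category.assoc, Category.assoc,
              ← Functor.map_comp, dist_comp₁₂ hU]
            simp
          · exfalso
            obtain ⟨c, hc⟩ := hL.exists_smul (hL.shift 1 hq) (hL.shift 1 hd) _ (u⟦(1 : ℤ)⟧')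
              (hL.comp_ne_zero (hL.shift 1 hq) hK' (hL.shift 1 hd) t b ht hb)
            apply shift_map_ne_zero hui 1
            rw [Functor.map_comp, hc, Linear.smul_comp, Category.assoc, dist_comp₃₁ hK]
            simp
      obtain ⟨e'⟩ := exists_iso_biprod_of_eq_zero o'.mem hzero
      obtain ⟨m, hm⟩ := hL.exists_finSum_cone hq hd hu hU
      obtain ⟨m', hm'⟩ : ∃ m', FinSum (Elem L) m' S := by
        obtain ⟨B', f', g', h', ⟨eB⟩, hB'⟩ := exists_dist_of_dist hm₁
        rcases hK' with hK' | ⟨hK', -⟩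
        · have : IsIso g' := (Triangle.isZero₁_iff_isIso₂ _ hB').1
            ((shiftFunctor C (-1 : ℤ)).map_isZero hK')
          exact ⟨n, hB.of_iso ((asIso g').symm ≪≫ eB)⟩
        · exact ih (hB.of_iso eB) (hL.shift (-1) hK') hB'
      exact ⟨_, (hm.add hm').of_iso e'⟩

end Cones

/-! ### Universal property of `addClosure` and the shape of objects in the closures. -/

section Closures

variable {C : Type u} [Category.{v} C] [Preadditive C] [HasZeroObject C] [HasShift C ℤ]
  [∀ n : ℤ, (shiftFunctor C n).Additive] [Pretriangulated C]

instance retractClosure_isClosedUnderBinaryProducts (P : ObjectProperty C)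
    [P.IsClosedUnderBinaryProducts] : P.retractClosure.IsClosedUnderBinaryProducts := by
  refine ObjectProperty.IsClosedUnderLimitsOfShape.mk' ?_
  rintro _ ⟨F, hF⟩
  obtain ⟨A, hA, ⟨a⟩⟩ := hF ⟨WalkingPair.left⟩
  obtain ⟨B, hB, ⟨b⟩⟩ := hF ⟨WalkingPair.right⟩
  let e : limit F ≅ F.obj ⟨WalkingPair.left⟩ ⨯ F.obj ⟨WalkingPair.right⟩ :=
    HasLimit.isoOfNatIso (diagramIsoPair F)
  refine ⟨A ⨯ B, P.prop_prod A B hA hB, ⟨⟨e.hom ≫ prod.map a.i b.i, prod.map a.r b.r ≫ e.inv, ?_⟩⟩⟩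
  simp

lemma addClosure_isClosedUnderBinaryProducts (X : C) :
    (addClosure X).IsClosedUnderBinaryProducts := by
  rw [addClosure, ObjectProperty.triangEnvelopeIter_zero]
  infer_instance

instance addClosure_isStableUnderShift (X : C) : (addClosure X).IsStableUnderShift ℤ :=
  (inferInstance : ((ObjectProperty.singleton X).triangEnvelopeIter 0).IsStableUnderShift ℤ)

instance addClosure_isStableUnderRetracts (X : C) : (addClosure X).IsStableUnderRetracts :=
  (inferInstance : ((ObjectProperty.singleton X).triangEnvelopeIter 0).IsStableUnderRetracts)

lemma mem_addClosure (X : C) : addClosure X X :=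
  ObjectProperty.le_triangEnvelopeIter _ 0 _ (by simp)

lemma addClosure_le_thickClosure (X : C) : addClosure X ≤ thickClosure X :=
  ObjectProperty.triangEnvelopeIter_le_triangEnvelope _ 0

lemma addClosure_le_of_mem {X Y : C} (h : addClosure Y X) : addClosure X ≤ addClosure Y := by
  have := addClosure_isClosedUnderBinaryProducts Y
  have hz : (addClosure Y).ContainsZero := ⟨_, isZero_zero C,
    (addClosure Y).prop_of_retract (Y := X) ⟨0, 0, (isZero_zero C).eq_of_src _ _⟩ h⟩
  conv_lhs => rw [addClosure, ObjectProperty.triangEnvelopeIter_zero]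
  rw [ObjectProperty.retractClosure_le_iff, ObjectProperty.binaryProductsClosure_le_iff,
    ObjectProperty.shiftClosure_le_iff]
  rintro _ ⟨⟩
  exact h

/-- An object of the thick closure is a retract of an iterated extension of objects of
`addClosure`. -/
lemma exists_of_thickClosure {X Y : C} (h : thickClosure X Y) :
    ∃ (n : ℕ) (Z : C), (addClosure X).extensionProductIter n Z ∧ Nonempty (Retract Y Z) := by
  obtain ⟨n, Z, hZ, r⟩ := (ObjectProperty.prop_triangEnvelope_iff _ _).1 h
  refine ⟨n, Z, ?_, r⟩
  rwa [addClosure, ObjectProperty.triangEnvelopeIter_zero]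

lemma indecomposable_shift {X : C} (hX : Indecomposable X) (n : ℤ) : Indecomposable (X⟦n⟧) := by
  have hz : ∀ (m : ℤ) (A : C), IsZero (A⟦m⟧) → IsZero A := fun m A h => by
    rw [IsZero.iff_id_eq_zero] at h ⊢
    exact (shiftFunctor C m).map_injective (by rw [CategoryTheory.Functor.map_id, h, Functor.map_zero])
  refine ⟨fun h => hX.1 (hz _ _ h), fun A B e => ?_⟩
  have : PreservesBinaryBiproducts (shiftFunctor C (-n)) :=
    preservesBinaryBiproducts_of_preservesBiproducts _
  let e' : X ≅ A⟦-n⟧ ⊞ B⟦-n⟧ := (shiftEquiv C n).unitIso.app X ≪≫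
    (shiftFunctor C (-n)).mapIso e ≪≫ (shiftFunctor C (-n)).mapBiprod A B
  exact (hX.2 _ _ e').imp (hz _ _) (hz _ _)

lemma indecomposable_of_iso {X Y : C} (hX : Indecomposable X) (e : Y ≅ X) : Indecomposable Y :=
  ⟨fun h => hX.1 (h.of_iso e.symm), fun A B e' => hX.2 A B (e.symm ≪≫ e')⟩

lemma isIndAddClosure_shift {G P : C} (h : IsIndAddClosure G P) (n : ℤ) :
    IsIndAddClosure G (P⟦n⟧) :=
  ⟨(addClosure G).le_shift n _ h.1, indecomposable_shift h.2 n⟩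

lemma isIndAddClosure_of_iso {G P Q : C} (h : IsIndAddClosure G P) (e : Q ≅ P) :
    IsIndAddClosure G Q :=
  ⟨(addClosure G).prop_of_iso e.symm h.1, indecomposable_of_iso h.2 e⟩

/-- The objects of `addClosure G` are direct sums of indecomposable objects of it. -/
lemma addClosure_finSum (hKS : IsKrullSchmidt C) {G X : C} (hX : addClosure G X) :
    ∃ n, FinSum (IsIndAddClosure G) n X := by
  obtain ⟨n, f, hf, ⟨e⟩⟩ := hKS X
  have h := ((FinSum.biproduct (P := fun A : C => IsLocalRing (End A)) f hf).of_iso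
    e).inf_of_retracts (addClosure G) hX
  exact ⟨n, h.mono fun A hA => ⟨hA.2, indecomposable_of_isLocalRing hA.1⟩⟩

end Closures

/-! ### Indecomposables of the thick closure. -/

section Classification

variable {C : Type u} [Category.{v} C] [Preadditive C] [HasZeroObject C] [HasShift C ℤ]
  [∀ n : ℤ, (shiftFunctor C n).Additive] [Pretriangulated C]
  {k : Type w} [Field k] [Linear k C] {L : ObjectProperty C}

lemma Elem.not_isZero (hL : LinFam k L) {Y : C} (hY : Elem L Y) : ¬ IsZero Y := by
  intro h
  rcases hY with hY | ⟨d, T, i, p, w, hd, hT, hw, hw', hdist⟩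
  · exact hL.not_isZero hY h
  · have : IsIso w := (Triangle.isZero₂_iff_isIso₃ _ hdist).1 h
    refine hL.not_isZero hT ((IsZero.iff_id_eq_zero _).2 ?_)
    rw [← IsIso.hom_inv_id w, hw' (inv w), comp_zero]

lemma Elem.of_iso (hiso : ∀ ⦃P Q : C⦄, L P → (Q ≅ P) → L Q) {Y Z : C} (hY : Elem L Y)
    (e : Z ≅ Y) : Elem L Z := by
  rcases hY with hY | ⟨d, T, i, p, w, hd, hT, hw, hw', hdist⟩
  · exact Or.inl (hiso hY e)
  · exact Or.inr ⟨d, T, i ≫ e.inv, e.hom ≫ p, w, hd, hT, hw, hw',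
      distinguished_of_iso hdist (Iso.refl _) e (Iso.refl _) (by simp) (by simp) (by simp)⟩

lemma IsChoice.bot (α : ∀ Y Z : C, Y ⟶ Z) : IsChoice k (Elem (⊥ : ObjectProperty C)) α where
  span _ _ h := by
    rcases h with h | ⟨_, _, _, _, _, h, _⟩ <;> exact h.elim
  comp _ _ _ h := by
    rcases h with h | ⟨_, _, _, _, _, h, _⟩ <;> exact h.elim

variable [∀ n : ℤ, (shiftFunctor C n).Linear k]

/-- The endomorphisms of the objects of `Elem L` are scalars. -/
lemma Elem.exists_smul_id (hL : LinFam k L) {Y : C} (hY : Elem L Y) (f : Y ⟶ Y) :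
    ∃ s : k, f = s • 𝟙 Y := by
  -- Extending from the empty family yields generators, so each endomorphism is a multiple of `β Y
  -- Y`, which is the identity.
  obtain ⟨β, hβ, -⟩ := hL.exists_isChoice_elem (L' := ⊥) bot_le
    (hL.mono bot_le fun _ _ h => h.elim) (IsChoice.bot fun _ _ => 0)
  obtain ⟨s, hs⟩ := hβ.span hY hY f
  exact ⟨s, by rw [hs, hβ.id_eq hY (hY.not_isZero hL)]⟩

lemma Elem.indecomposable (hL : LinFam k L) {Y : C} (hY : Elem L Y) : Indecomposable Y := by
  refine ⟨hY.not_isZero hL, fun A B e => ?_⟩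
  obtain ⟨s, hs⟩ := hY.exists_smul_id hL (e.hom ≫ biprod.fst ≫ biprod.inl ≫ e.inv)
  by_cases h0 : s = 0
  · left
    rw [h0, zero_smul] at hs
    rw [IsZero.iff_id_eq_zero]
    have : 𝟙 A = biprod.inl ≫ e.inv ≫ (e.hom ≫ biprod.fst ≫ biprod.inl ≫ e.inv) ≫
      e.hom ≫ biprod.fst := by simp
    rw [this, hs]
    simp
  · right
    rw [IsZero.iff_id_eq_zero]
    have h1 : (biprod.inr ≫ e.inv : B ⟶ Y) ≫ (e.hom ≫ biprod.fst ≫ biprod.inl ≫ e.inv) = 0 := by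
      simp
    rw [hs, Linear.comp_smul, Category.comp_id] at h1
    have h2 : (biprod.inr ≫ e.inv : B ⟶ Y) = 0 := (smul_eq_zero.1 h1).resolve_left h0
    have h3 : 𝟙 B = (biprod.inr ≫ e.inv) ≫ e.hom ≫ biprod.snd := by simp
    rw [h3, h2, zero_comp]

/-- A nonzero retract of an object of `Elem L` is isomorphic to it. -/
lemma Elem.nonempty_iso_of_retract (hL : LinFam k L) {Y A : C} (hY : Elem L Y) (r : Retract A Y)
    (hA : ¬ IsZero A) : Nonempty (A ≅ Y) := by
  obtain ⟨s, hs⟩ := hY.exists_smul_id hL (r.r ≫ r.i)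
  have h1 : r.i ≫ (r.r ≫ r.i) ≫ r.r = 𝟙 A := by simp
  have h2 : s • 𝟙 A = (1 : k) • 𝟙 A := by
    rw [one_smul]
    nth_rw 2 [← h1]
    rw [hs]
    simp
  have hs1 : s = 1 :=
    smul_left_injective k (fun e => hA ((IsZero.iff_id_eq_zero A).2 e)) h2
  exact ⟨⟨r.i, r.r, r.retract, by rw [hs, hs1, one_smul]⟩⟩

/-- An extension of a direct sum of objects of `L` by a direct sum of objects of `Elem L`. -/
lemma FinSum.extension [IsTriangulated C] (hL : LinFam k L) {n m : ℕ} {X Y B : C}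
    (hX : FinSum (Elem L) m X) (hB : FinSum L n B) {f : X ⟶ Y} {g : Y ⟶ B} {h : B ⟶ X⟦(1 : ℤ)⟧}
    (hT : Triangle.mk f g h ∈ distTriang C) : ∃ m', FinSum (Elem L) m' Y := by
  induction n generalizing m X Y B with
  | zero =>
    have : IsIso f := (Triangle.isZero₃_iff_isIso₁ _ hT).1 hB.isZero
    exact ⟨m, hX.of_iso (@asIso _ _ _ _ f this).symm⟩
  | succ n ih =>
    cases hB with
    | @cons _ _ b B' hb hB' e =>
      have h1 : ObjectProperty.extensionProduct L (FinSum L n) B := by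
        exact ⟨b, B', biprod.inl ≫ e.inv, e.hom ≫ biprod.snd, 0,
          distinguished_of_iso (binaryBiproductTriangle_distinguished b B') (Iso.refl b) e
            (Iso.refl B') (by simp) (by simp) (by simp), hb, hB'⟩
      -- Associativity of extensions peels off one summand: extending `X` by `b` amounts to a cone
      -- of a morphism out of `b⟦-1⟧`, and the rest is induction.
      have h2 : ObjectProperty.extensionProduct (FinSum (Elem L) m)
          (ObjectProperty.extensionProduct L (FinSum L n)) Y := ⟨X, B, f, g, h, hT, hX, h1⟩
      rw [← ObjectProperty.extensionProduct_assoc] at h2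
      obtain ⟨X₂, B₂, f₂, g₂, h₂, hT₂, ⟨X₁, b₁, f₁, g₁, h₁, hT₁, hX₁, hb₁⟩, hB₂⟩ := h2
      obtain ⟨m₂, hm₂⟩ := hX₁.cone hL (hL.shift (-1) hb₁) (inv_rot_of_distTriang _ hT₁)
      exact ih hm₂ hB₂ hT₂

/-- The indecomposable objects of the thick closure of `G` are the indecomposable objects of
`addClosure G` and the fibers of morphisms between them. -/
theorem elem_of_indecomposable [IsTriangulated C] (hKS : IsKrullSchmidt C) {G : C}
    (hL : LinFam k (IsIndAddClosure G)) {Y : C} (hY : thickClosure G Y) (hi : Indecomposable Y) :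
    Elem (IsIndAddClosure G) Y := by
  obtain ⟨n, Z, hZ, ⟨r⟩⟩ := exists_of_thickClosure hY
  obtain ⟨m, hm⟩ : ∃ m, FinSum (Elem (IsIndAddClosure G)) m Z := by
    clear r
    induction n generalizing Z with
    | zero =>
      obtain ⟨m, hm⟩ := addClosure_finSum hKS hZ
      exact ⟨m, hm.mono (le_elem _)⟩
    | succ n ih =>
      rw [ObjectProperty.extensionProductIter_succ'] at hZ
      obtain ⟨X, B, f, g, h, hT, hX, hB⟩ := hZ
      obtain ⟨m, hm⟩ := ih _ hX
      obtain ⟨m', hm'⟩ := addClosure_finSum hKS hB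
      exact hm.extension hL hm' hT
  -- By Krull–Schmidt `Y` is isomorphic to an object with local endomorphism ring, hence is a
  -- retract of a single summand of `Z`. That summand has scalar endomorphisms, so the retract is
  -- everything.
  obtain ⟨l, f, hf, ⟨e⟩⟩ := hKS Y
  obtain ⟨A, hA, ⟨e'⟩⟩ := FinSum.exists_iso_of_indecomposable
    (fun A hA => (indecomposable_of_isLocalRing hA).1) hi
    ((FinSum.biproduct (P := fun A : C => IsLocalRing (End A)) f hf).of_iso e)
  obtain ⟨E, hE, ⟨r'⟩⟩ := hm.exists_retract hA ((Retract.ofIso e'.symm).trans r)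
  obtain ⟨e''⟩ := hE.nonempty_iso_of_retract hL r' (indecomposable_of_isLocalRing hA).1
  exact hE.of_iso (fun _ _ h e => isIndAddClosure_of_iso h e) (e' ≪≫ e'')

end Classification

/-! ### From the axioms of a linear generator to the theorem. -/

section Main

variable {C : Type u} [Category.{v} C] [Preadditive C] [HasZeroObject C] [HasShift C ℤ]
  [∀ n : ℤ, (shiftFunctor C n).Additive] [Pretriangulated C]
  {k : Type w} [Field k] [Linear k C]

/-- Composites are nonzero by (G4): transitivity gives a nonzero `P ⟶ R`, it factors through `Q`,
and its factors are multiples of `f` and `g`. -/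
lemma IsLinearGenerator.linFam {G : C} (hG : IsLinearGenerator k G) :
    LinFam k (IsIndAddClosure G) := by
  have hnz : ∀ {P Q : C}, HomLE k Q P → ∃ f : P ⟶ Q, f ≠ 0 := by
    rintro P Q ⟨φ⟩
    exact ⟨φ.symm 1, fun h => one_ne_zero (φ.symm.map_eq_zero_iff.1 h)⟩
  have hle : ∀ {P Q : C}, IsIndAddClosure G P → IsIndAddClosure G Q → ∀ f : P ⟶ Q, f ≠ 0 →
      HomLE k Q P := by
    intro P Q hP hQ f hf
    rcases hG.le_total Q P hQ hP with h | h
    · exact h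
    · by_cases e : Nonempty (P ≅ Q)
      · obtain ⟨e⟩ := e
        obtain ⟨φ⟩ := hG.le_refl P hP
        exact ⟨(Linear.homCongr k (Iso.refl P) e).symm.trans φ⟩
      · exact (hf (hG.hom_eq_zero P Q hP hQ h e f)).elim
  have hsmul : ∀ {P Q : C}, IsIndAddClosure G P → IsIndAddClosure G Q → ∀ f g : P ⟶ Q, f ≠ 0 →
      ∃ s : k, g = s • f := by
    intro P Q hP hQ f g hf
    obtain ⟨φ⟩ := hle hP hQ f hf
    refine ⟨φ g / φ f, φ.injective ?_⟩
    have : φ f ≠ 0 := fun h => hf (φ.map_eq_zero_iff.1 h)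
    rw [map_smul, smul_eq_mul, div_mul_cancel₀ _ this]
  refine ⟨fun n P hP => isIndAddClosure_shift hP n, fun P hP => hP.2.1,
    fun P Q hP hQ => hsmul hP hQ, fun P Q R hP hQ hR f g hf hg => ?_, fun P Q hP hQ => ?_,
    fun P hP => hnz (hG.le_shift P hP)⟩
  · have h1 := hle hP hQ f hf
    have h2 := hle hQ hR g hg
    obtain ⟨t, ht⟩ := hnz (hG.le_trans R Q P hR hQ hP h2 h1)
    obtain ⟨f', g', -, -, rfl⟩ := hG.factors R Q P hR hQ hP h2 h1 t ht
    obtain ⟨a, rfl⟩ := hsmul hP hQ f f' hf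
    obtain ⟨b, rfl⟩ := hsmul hQ hR g g' hg
    intro h0
    apply ht
    rw [Linear.smul_comp, Linear.comp_smul, h0, smul_zero, smul_zero]
  · exact (hG.le_total Q P hQ hP).imp hnz hnz

/-- A nonzero composite of generators is a nonzero multiple of `α Y Z`, which therefore factors
through `W`. -/
lemma IsGeneratorChoice.isChoice {S S' : ObjectProperty C} {α : ∀ Y Z : C, Y ⟶ Z}
    (h : IsGeneratorChoice k S α) (hS : ∀ Y, S' Y → S Y ∧ Indecomposable Y) :
    IsChoice k S' α where
  span Y Z hY hZ f := by
    have : f ∈ Submodule.span k {α Y Z} := by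
      rw [h.span_eq_top Y Z (hS _ hY).1 (hS _ hZ).1 (hS _ hY).2 (hS _ hZ).2]
      trivial
    obtain ⟨s, hs⟩ := Submodule.mem_span_singleton.1 this
    exact ⟨s, hs.symm⟩
  comp Y W Z hY hW hZ h0 := by
    have : α Y W ≫ α W Z ∈ Submodule.span k {α Y Z} := by
      rw [h.span_eq_top Y Z (hS _ hY).1 (hS _ hZ).1 (hS _ hY).2 (hS _ hZ).2]
      trivial
    obtain ⟨s, hs⟩ := Submodule.mem_span_singleton.1 this
    have hs0 : s ≠ 0 := by rintro rfl; exact h0 (by rw [← hs, zero_smul])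
    refine (h.eq_comp Y W Z (hS _ hY).1 (hS _ hW).1 (hS _ hZ).1 (hS _ hY).2 (hS _ hW).2
      (hS _ hZ).2 ⟨s⁻¹ • α Y W, α W Z, ?_⟩).symm
    rw [Linear.smul_comp, ← hs, smul_smul, inv_mul_cancel₀ hs0, one_smul]

lemma IsChoice.isGeneratorChoice {S S' : ObjectProperty C} {α : ∀ Y Z : C, Y ⟶ Z}
    (h : IsChoice k S' α) (hS : ∀ Y, S Y → Indecomposable Y → S' Y) :
    IsGeneratorChoice k S α where
  span_eq_top Y Z hY hZ hY' hZ' := by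
    refine eq_top_iff.2 fun f _ => ?_
    obtain ⟨s, hs⟩ := h.span (hS _ hY hY') (hS _ hZ hZ') f
    exact Submodule.mem_span_singleton.2 ⟨s, hs.symm⟩
  eq_comp Y W Z hY hW hZ hY' hW' hZ' := by
    rintro ⟨f, g, hfg⟩
    by_cases h0 : α Y W ≫ α W Z = 0
    · obtain ⟨s, rfl⟩ := h.span (hS _ hY hY') (hS _ hW hW') f
      obtain ⟨t, rfl⟩ := h.span (hS _ hW hW') (hS _ hZ hZ') g
      rw [← hfg, Linear.smul_comp, Linear.comp_smul, h0, smul_zero, smul_zero]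
    · exact (h.comp (hS _ hY hY') (hS _ hW hW') (hS _ hZ hZ') h0).symm

lemma thickClosure_of_elem [IsTriangulated C] {G Y : C} (hY : Elem (IsIndAddClosure G) Y) :
    thickClosure G Y := by
  rcases hY with hY | ⟨d, T, i, p, w, hd, hT, -, -, h⟩
  · exact addClosure_le_thickClosure G _ hY.1
  · exact ((ObjectProperty.singleton G).triangEnvelope).ext_of_isTriangulatedClosed₂ _ h
      (addClosure_le_thickClosure G _ hd.1) (addClosure_le_thickClosure G _ hT.1)

end Main

theorem mainTheorem10 (k : Type w) [Field k]
    (C : Type u) [Category.{v} C] [Preadditive C] [HasZeroObject C] [HasShift C ℤ]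
    [∀ n : ℤ, (shiftFunctor C n).Additive] [Pretriangulated C] [IsTriangulated C]
    [Linear k C] [∀ n : ℤ, (shiftFunctor C n).Linear k]
    (hfin : IsHomFinite C k) (hKS : IsKrullSchmidt C)
    (G : C) (hG : IsLinearGenerator k G) :
    (∃ α : ∀ Y Z : C, Y ⟶ Z, IsGeneratorChoice k ⊤ α) ∧
    (∀ G' H : C, Nonempty (G ≅ G' ⊞ H) →
      ∀ α : ∀ Y Z : C, Y ⟶ Z, IsGeneratorChoice k (thickClosure G') α →
        ∃ β : ∀ Y Z : C, Y ⟶ Z, IsGeneratorChoice k ⊤ β ∧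
          ∀ Y Z : C, thickClosure G' Y → thickClosure G' Z →
            Indecomposable Y → Indecomposable Z → β Y Z = α Y Z) := by
  have hL := hG.linFam
  have htop : ∀ Y : C, Indecomposable Y → Elem (IsIndAddClosure G) Y := fun Y hY =>
    elem_of_indecomposable hKS hL (by rw [hG.classical_generator]; trivial) hY
  refine ⟨?_, fun G' H ⟨e⟩ α hα => ?_⟩
  · obtain ⟨β, hβ, -⟩ := hL.exists_isChoice_elem (L' := ⊥) bot_le
      (hL.mono bot_le fun _ _ h => h.elim) (IsChoice.bot fun _ _ => 0)
    exact ⟨β, hβ.isGeneratorChoice fun Y _ => htop Y⟩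
  · have hG' : addClosure G G' := (addClosure G).prop_of_retract
      (⟨biprod.inl ≫ e.inv, e.hom ≫ biprod.fst, by simp⟩ : Retract G' G) (mem_addClosure G)
    have hLL : IsIndAddClosure G' ≤ IsIndAddClosure G := fun P hP =>
      ⟨addClosure_le_of_mem hG' _ hP.1, hP.2⟩
    have hL' : LinFam k (IsIndAddClosure G') :=
      hL.mono hLL fun n P hP => isIndAddClosure_shift hP n
    obtain ⟨β, hβ, hβα⟩ := hL.exists_isChoice_elem hLL hL'
      (hα.isChoice fun Y hY => ⟨thickClosure_of_elem hY, hY.indecomposable hL'⟩)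
    exact ⟨β, hβ.isGeneratorChoice fun Y _ => htop Y, fun Y Z hY hZ hY' hZ' =>
      hβα Y Z (elem_of_indecomposable hKS hL' hY hY') (elem_of_indecomposable hKS hL' hZ hZ')⟩
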